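/- Let $\Gamma$ be a finite connected 4-valent graph cellularly embedded in the closed oriented surface of genus $g$, all of whose faces have even degree. Put a qubit on every edge and on every vertex of $\Gamma$. Each corner of $\Gamma$ (a vertex $v$ and two consecutive edges $e,e'$ at $v$) gives a triangle on the qubits $e,e',v$. Assume that the triangles are coloured with $X$ and $Z$ such that triangles at consecutive corners around a vertex, and triangles at consecutive corners around a face, have different colours. The *generalized subsystem surface code* has the gauge group $\mathcal G$ generated by the operators $X_eX_{e'}X_v$ for the $X$-triangles and $Z_eZ_{e'}Z_v$ for the $Z$-triangles. For a face $f$ and $\tau\in\{X,Z\}$ let $s_f^\tau$ be the product of the $\tau$-type gauge operators at the corners of $f$. For $\kappa\in\{X,Z\}$ with opposite type $\bar\kappa$, let $\Gamma_\kappa$ be the graph whose vertices are the faces of $\Gamma$ (the $f$-faces) and whose edges are the qubits: the qubit on an edge of $\Gamma$ joins the two faces on its sides, and the qubit on a vertex $v$ joins the two faces whose triangles at $v$ have type $\bar\kappa$. The surface code of an embedded graph has one qubit per edge; its stabilizer is generated by vertex operators of one type and face operators of the other type (edges counted modulo 2). A *surface-code decoder* is any procedure that, given the surface code of a connected graph embedded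 in a closed oriented surface (the two ends and the two sides of each edge) and the syndrome at the vertices of some error of the type that the vertex operators detect, returns an error of this type with that syndrome. Syndrome bits are $s\in\{0,1\}$ with $hE=(-1)^sEh$. **Theorem.** 1. Each $s_f^\tau$ lies in $\mathcal G$ and commutes with all of $\mathcal G$. 2. $\Gamma_\kappa$ is cellularly embedded in the connected closed oriented surface of the same genus $g$, and its faces are the $\kappa$-type triangles. The $s_f^{\bar\kappa}$ are its vertex operators and the $\kappa$-type gauge generators are its face operators. 3. $X$ and $Z$ errors decouple: for every Pauli error $E$, the syndrome of $E$ with respect to the $s_f^{\bar\kappa}$ depends only on the $\kappa$-part of $E$, and equals the surface-code syndrome on $\Gamma_\kappa$ of this part. 4. Errors lift one-to-one: every Pauli error is, up to a power of $i$, the product $X(y_X)Z(y_Z)$ for exactly one pair of sets $y_X$ of edges of $\Gamma_X$ and $y_Z$ of edges of $\Gamma_Z$. 5. If $y_X,y_Z$ have the syndromes that $E$ projects to $\Gamma_X,\Gamma_Z$, then $\hat E=X(y_X)Z(y_Z)$ has the same syndrome as $E$; and $E\hat E\in\langle iI,\mathcal G\rangle$ if and only if, on both $\Gamma_X$ and $\Gamma_Z$,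 the product of the projected error and its estimate lies in the stabilizer of the surface code. 6. Decoding is efficient: on a random access machine with unit-cost addition, subtraction and memory access there are a fixed program and a constant $c$ such that, for every surface-code decoder and every such code with $n=3|V(\Gamma)|$ qubits, the program, given $\Gamma$, the colouring and the syndrome of an error $E$, builds $\Gamma_X$ and $\Gamma_Z$ with the projected syndromes, calls the decoder on each of them, and outputs the two returned estimates. The lifted estimate $\hat E$ has the syndrome of $E$ and satisfies the equivalence of part 5, and the program takes at most $c\,n$ steps plus the time of the two calls. Moreover there is a surface-code decoder, given by a program of the same machine, with which the total number of steps is at most a polynomial in $n$. -/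

import Mathlib

open Equiv

/-! ## Pauli operators -/

/-- The two types of Pauli operator, bit flip and phase flip. -/
inductive Kind : Type
  | X : Kind
  | Z : Kind
  deriving DecidableEq

/-- The other type. -/
def Kind.swap : Kind → Kind
  | .X => .Z
  | .Z => .X

/-- The `n`-qubit Pauli group with the qubits indexed by `Q`: `⟨k, x, z⟩` is the operator
`i ^ k * ∏ X_q ^ (x q) * ∏ Z_q ^ (z q)`. -/
@[ext]
structure Pauli (Q : Type) where
  phase : ZMod 4
  x : Q → ZMod 2
  z : Q → ZMod 2

namespace Pauli

variable {Q : Type}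

/-- The exponent of `i` in the sign `(-1) ^ t`. -/
def sgn (t : ZMod 2) : ZMod 4 := 2 * (t.val : ZMod 4)

theorem sgn_add : ∀ s t : ZMod 2, sgn (s + t) = sgn s + sgn t := by decide

theorem sgn_zero : sgn 0 = 0 := by decide

theorem sgn_add_self : ∀ t : ZMod 2, sgn t + sgn t = 0 := by decide

/-- Multiplication of Pauli operators, from `Z X = - X Z` on a common qubit. -/
instance [Fintype Q] : Mul (Pauli Q) :=
  ⟨fun a b => ⟨a.phase + b.phase + sgn (∑ q, a.z q * b.x q), a.x + b.x, a.z + b.z⟩⟩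

instance : One (Pauli Q) := ⟨⟨0, 0, 0⟩⟩

instance [Fintype Q] : Inv (Pauli Q) := ⟨fun a => ⟨-a.phase + sgn (∑ q, a.z q * a.x q), a.x, a.z⟩⟩

theorem mul_def [Fintype Q] (a b : Pauli Q) :
    a * b = ⟨a.phase + b.phase + sgn (∑ q, a.z q * b.x q), a.x + b.x, a.z + b.z⟩ := rfl

theorem one_def : (1 : Pauli Q) = ⟨0, 0, 0⟩ := rfl

theorem inv_def [Fintype Q] (a : Pauli Q) :
    a⁻¹ = ⟨-a.phase + sgn (∑ q, a.z q * a.x q), a.x, a.z⟩ := rfl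

instance [Fintype Q] : Group (Pauli Q) :=
  Group.ofLeftAxioms
    (by
      intro a b c
      simp only [mul_def, Pi.add_apply, add_mul, mul_add, Finset.sum_add_distrib, sgn_add]
      ext
      · simp only; ring
      · simp only [Pi.add_apply, add_assoc]
      · simp only [Pi.add_apply, add_assoc])
    (by
      intro a
      simp [mul_def, one_def, sgn_zero])
    (by
      intro a
      have h2 : ∀ t : ZMod 2, t + t = 0 := by decide
      simp only [mul_def, one_def, inv_def]
      ext
      · simp only
        have := sgn_add_self (∑ q, a.z q * a.x q)
        linear_combination this
      · simp [h2]
      · simp [h2])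

/-- The scalar operator `i I`. -/
def imag : Pauli Q := ⟨1, 0, 0⟩

/-- The operator `∏ X_q ^ (y q)` or `∏ Z_q ^ (y q)`. -/
def op : Kind → (Q → ZMod 2) → Pauli Q
  | .X, y => ⟨0, y, 0⟩
  | .Z, y => ⟨0, 0, y⟩

/-- Products of operators of one type correspond to sums of exponent vectors. -/
theorem op_add [Fintype Q] (κ : Kind) (y y' : Q → ZMod 2) : op κ (y + y') = op κ y * op κ y' := by
  cases κ <;> simp [op, mul_def, sgn_zero]

/-- The bit-flip part or the phase-flip part of an operator. -/
def part (P : Pauli Q) : Kind → Q → ZMod 2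
  | .X => P.x
  | .Z => P.z

open Classical in
/-- The syndrome bit `s` of the error `P` for the check `h`, that is `h P = (-1) ^ s P h`. -/
noncomputable def syndrome [Fintype Q] (h P : Pauli Q) : ZMod 2 := if Commute h P then 0 else 1

end Pauli

/-! ## Graphs on closed oriented surfaces and their surface codes -/

/-- A finite graph cellularly embedded in a closed oriented surface, as a rotation system.
`D` is the set of darts (an edge with a direction); `σ` rotates a dart counterclockwise about
its tail, and `α` reverses it. Going once along a dart and then turning left, that is applying
`σ⁻¹ * α`, walks around the face on the left of the dart. `vert d` is the tail of `d`, `edge d`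
its edge, `face d` the face on its left: they name the orbits of `σ`, of `α` and of `σ⁻¹ * α`
by the elements of `V`, `E`, `F`. -/
structure EmbeddedGraph (D V E F : Type) where
  σ : Perm D
  α : Perm D
  α_α : ∀ d, α (α d) = d
  α_ne : ∀ d, α d ≠ d
  vert : D → V
  edge : D → E
  face : D → F
  vert_surj : Function.Surjective vert
  edge_surj : Function.Surjective edge
  face_surj : Function.Surjective face
  vert_eq_iff : ∀ d d', vert d = vert d' ↔ σ.SameCycle d d'
  edge_eq_iff : ∀ d d', edge d = edge d' ↔ α.SameCycle d d'
  face_eq_iff : ∀ d d', face d = face d' ↔ (σ⁻¹ * α).SameCycle d d'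

namespace EmbeddedGraph

variable {D V E F : Type} (M : EmbeddedGraph D V E F)

/-- The next dart on the boundary of the face on the left. -/
def φ : Perm D := M.σ⁻¹ * M.α

/-- The graph, equivalently the surface, is connected and nonempty. -/
def Connected : Prop :=
  Nonempty D ∧ ∀ d d', Relation.EqvGen (fun a b => b = M.σ a ∨ b = M.α a) d d'

/-- The surface is the connected closed oriented surface of genus `g`. -/
def HasGenus [Fintype V] [Fintype E] [Fintype F] (g : ℕ) : Prop :=
  M.Connected ∧
    (Fintype.card V : ℤ) - (Fintype.card E : ℤ) + (Fintype.card F : ℤ) = 2 - 2 * (g : ℤ)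

variable [Fintype D] [Fintype E]

open Classical in
/-- The edges incident with a vertex, modulo 2. -/
noncomputable def star (v : V) : E → ZMod 2 := ∑ d : D with M.vert d = v, Pi.single (M.edge d) 1

open Classical in
/-- The edges on the boundary of a face, modulo 2. -/
noncomputable def plaquette (f : F) : E → ZMod 2 := ∑ d : D with M.face d = f, Pi.single (M.edge d) 1

/-- The surface code of the embedded graph, one qubit per edge: its stabilizer is generated by
the vertex operators, of type `τ`, and the face operators, of the other type. -/
noncomputable def surfaceStabilizer (τ : Kind) : Subgroup (Pauli E) :=
  Subgroup.closure
    (Set.range (fun v => Pauli.op τ (M.star v)) ∪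
      Set.range (fun f => Pauli.op τ.swap (M.plaquette f)))

open Classical in
/-- The vertices which an odd number of ends of edges of `y` meet. -/
noncomputable def boundary (y : E → ZMod 2) (v : V) : ZMod 2 := ∑ d : D with M.vert d = v, y (M.edge d)

end EmbeddedGraph

/-! ## Generalized subsystem surface codes -/

/-- The data of the construction: a 4-valent graph on a surface all of whose faces are even,
and the two-colouring of the triangles. There is one triangle at each corner of the graph; the
corner between `d` and `σ d` at the tail of `d` is named `d`, and it lies in the face on the
left of `d`. Triangles that follow each other around a vertex, or around a face, have different
colours. -/
structure SubsystemSurfaceCode (D V E F : Type) extends EmbeddedGraph D V E F where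
  four_valent : ∀ v, Nat.card {d // vert d = v} = 4
  even_faces : ∀ f, Even (Nat.card {d // face d = f})
  col : D → Kind
  col_vert : ∀ d, col (σ d) ≠ col d
  col_face : ∀ d, col ((σ⁻¹ * α) d) ≠ col d

theorem Kind.eq_swap_iff : ∀ a b : Kind, a = b.swap ↔ a ≠ b := by
  intro a b; cases a <;> cases b <;> simp [Kind.swap]

theorem Kind.eq_of_ne_swap {a b : Kind} (h : a ≠ b.swap) : a = b := by
  cases a <;> cases b <;> simp_all [Kind.swap]

/-- A function that a permutation preserves is constant on its cycles. -/
theorem eq_of_sameCycle {A B : Type} {π : Perm A} {h : A → B} (hh : ∀ a, h (π a) = h a)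
    {a b : A} (hab : π.SameCycle a b) : h a = h b := by
  obtain ⟨k, rfl⟩ := hab
  have key : ∀ n : ℕ, ∀ a, h ((π ^ n) a) = h a := by
    intro n
    induction n with
    | zero => simp
    | succ n ih => intro a; rw [pow_succ', Perm.mul_apply, hh, ih]
  rcases k with k | k
  · simpa using (key k a).symm
  · have := key (k + 1) ((π ^ (Int.negSucc k)) a)
    rw [zpow_negSucc, ← Perm.mul_apply, mul_inv_cancel, Perm.one_apply] at this
    rw [zpow_negSucc]; exact this

namespace SubsystemSurfaceCode

variable {D V E F : Type} (C : SubsystemSurfaceCode D V E F)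

/-- The qubits are the edges of the graph, that is the vertices of the medial graph, and the
vertices of the graph, that is the centres of the `v`-faces. -/
abbrev Qubit (E V : Type) : Type := E ⊕ V


theorem σ_pow_four (d : D) : C.σ (C.σ (C.σ (C.σ d))) = d ∧ C.σ (C.σ d) ≠ d := by
  classical
  set m := Function.minimalPeriod C.σ d with hm
  have h1 : (Set.range fun n : ℕ => (C.σ ^ n) d) = {d' | C.vert d' = C.vert d} := by
    have hcard := C.four_valent (C.vert d)
    have hfin : Finite {d' // C.vert d' = C.vert d} := Nat.finite_of_card_ne_zero (by omega)
    ext d'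
    constructor
    · rintro ⟨n, rfl⟩
      exact ((C.vert_eq_iff _ _).2 ⟨n, by simp⟩).symm
    · intro h
      have hs : C.σ.SameCycle d d' := (C.vert_eq_iff _ _).1 h.symm
      have hper : d ∈ Function.periodicPts C.σ := by
        have hinj : ¬ Function.Injective
            (fun n : ℕ => (⟨(C.σ ^ n) d, ((C.vert_eq_iff _ _).2 ⟨n, by simp⟩).symm⟩ :
              {d' // C.vert d' = C.vert d})) := not_injective_infinite_finite _
        simp only [Function.Injective, not_forall, Subtype.mk.injEq] at hinj
        obtain ⟨a, b, hab, hne⟩ := hinj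
        wlog hlt : a < b generalizing a b
        · exact this b a hab.symm (Ne.symm hne) (by omega)
        refine Function.mk_mem_periodicPts (n := b - a) (by omega) ?_
        have : (C.σ ^ a) ((C.σ ^ (b - a)) d) = (C.σ ^ a) d := by
          rw [← Perm.mul_apply, ← pow_add, Nat.add_sub_cancel' hlt.le, hab]
        have := (C.σ ^ a).injective this
        rwa [Function.IsPeriodicPt, Function.IsFixedPt, ← Perm.coe_pow]
      obtain ⟨k, rfl⟩ := hs
      have hpos : 0 < m := Function.minimalPeriod_pos_of_mem_periodicPts hper
      have hm0 : (C.σ ^ m) d = d := by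
        have := Function.iterate_minimalPeriod (f := C.σ) (x := d)
        rwa [← Perm.coe_pow] at this
      refine ⟨(k % m).toNat, ?_⟩
      have hmod : 0 ≤ k % (m : ℤ) := Int.emod_nonneg _ (by omega)
      have hz : ∀ j : ℤ, ((C.σ ^ m) ^ j) d = d := fun j =>
        Perm.zpow_apply_eq_self_of_apply_eq_self hm0 j
      show (C.σ ^ (k % m).toNat) d = (C.σ ^ k) d
      rw [← zpow_natCast, Int.toNat_of_nonneg hmod]
      conv_rhs => rw [← Int.emod_add_mul_ediv k m, zpow_add, Perm.mul_apply, zpow_mul,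
        zpow_natCast, hz]
  have h2 : (Set.range fun n : ℕ => (C.σ ^ n) d).ncard = 4 := by
    rw [h1]; exact C.four_valent (C.vert d)
  have h3 : m = 4 := by
    have hpos : m ≠ 0 := by
      intro h0
      have hinj : Function.Injective fun n : ℕ => (C.σ ^ n) d := by
        intro a b hab
        have : Function.Injective fun n : ℕ => (C.σ)^[n] d := by
          intro a b hab
          by_contra hne
          wlog hlt : a < b generalizing a b
          · exact this hab.symm (Ne.symm hne) (by omega)
          have h0' := Function.minimalPeriod_eq_zero_iff_notMem_periodicPts.1 (hm ▸ h0)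
          apply h0'
          refine Function.mk_mem_periodicPts (n := b - a) (by omega) ?_
          have h5 : (C.σ)^[a] ((C.σ)^[b - a] d) = (C.σ)^[a] d := by
            rw [← Function.iterate_add_apply, Nat.add_sub_cancel' hlt.le]; exact hab.symm
          exact (C.σ.injective.iterate a) h5
        apply this; simpa [← Perm.coe_pow] using hab
      have : (Set.range fun n : ℕ => (C.σ ^ n) d).Infinite := Set.infinite_range_of_injective hinj
      rw [this.ncard] at h2; omega
    have h4 : (Set.range fun n : ℕ => (C.σ ^ n) d) =
        (fun n : ℕ => (C.σ)^[n] d) '' (Finset.range m : Set ℕ) := by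
      ext d'
      simp only [Set.mem_range, Set.mem_image, Finset.coe_range, Set.mem_Iio]
      constructor
      · rintro ⟨n, rfl⟩
        refine ⟨n % m, Nat.mod_lt _ (Nat.pos_of_ne_zero hpos), ?_⟩
        rw [Function.iterate_mod_minimalPeriod_eq, Perm.coe_pow]
      · rintro ⟨n, _, rfl⟩
        exact ⟨n, by rw [Perm.coe_pow]⟩
    rw [h4, Set.InjOn.ncard_image, Set.ncard_coe_finset, Finset.card_range] at h2
    · exact h2
    · intro a ha b hb hab
      simp only [Finset.coe_range, Set.mem_Iio] at ha hb
      exact (Function.iterate_eq_iterate_iff_of_lt_minimalPeriod ha hb).1 hab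
  constructor
  · have := Function.iterate_minimalPeriod (f := C.σ) (x := d)
    rw [← hm, h3] at this
    exact this
  · intro h
    have : Function.IsPeriodicPt C.σ 2 d := h
    have := this.minimalPeriod_le (by norm_num)
    omega

theorem col_σ (d : D) : C.col (C.σ d) = (C.col d).swap :=
  (Kind.eq_swap_iff _ _).2 (C.col_vert d)

theorem col_φ (d : D) : C.col (C.φ d) = (C.col d).swap :=
  (Kind.eq_swap_iff _ _).2 (C.col_face d)

theorem Kind_swap_swap (κ : Kind) : κ.swap.swap = κ := by cases κ <;> rfl

theorem σ_φ (d : D) : C.σ (C.φ d) = C.α d := by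
  simp [EmbeddedGraph.φ, Perm.mul_apply]

theorem φ_α_σ (d : D) : C.φ (C.α (C.σ d)) = d := by
  apply C.σ.injective
  rw [σ_φ, C.α_α]

theorem col_α (d : D) : C.col (C.α d) = C.col d := by
  rw [← σ_φ, col_σ, col_φ, Kind_swap_swap]

theorem col_α_σ (d : D) : C.col (C.α (C.σ d)) = (C.col d).swap := by
  rw [col_α, col_σ]

theorem vert_σ (d : D) : C.vert (C.σ d) = C.vert d :=
  ((C.vert_eq_iff _ _).2 ⟨1, by simp⟩).symm

theorem edge_α (d : D) : C.edge (C.α d) = C.edge d :=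
  ((C.edge_eq_iff _ _).2 ⟨1, by simp⟩).symm

theorem face_φ (d : D) : C.face (C.φ d) = C.face d :=
  ((C.face_eq_iff _ _).2 ⟨1, by simp [EmbeddedGraph.φ]⟩).symm

/-- Darts of the decoding graph: for each dart `d` of the original graph, the dual dart, which
crosses `d` from the face on its left to the face on its right; and for each corner whose
triangle has the type opposite to `κ`, the dart that enters the vertex through this corner and
leaves it through the opposite one. -/
abbrev DecodingDart (κ : Kind) : Type := D ⊕ {d : D // C.col d = κ.swap}

/-- Rotation about a face: the edge `d`, then the corner between `d` and the next edge, if its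
triangle has the type opposite to `κ`, then the next edge. -/
def decodingRotation (κ : Kind) : Perm (C.DecodingDart κ) where
  toFun := Sum.elim
    (fun d => if h : C.col (C.φ d) = κ.swap then .inr ⟨C.φ d, h⟩ else .inl (C.φ d))
    (fun d => .inl d.1)
  invFun := Sum.elim
    (fun d => if h : C.col d = κ.swap then .inr ⟨d, h⟩ else .inl (C.α (C.σ d)))
    (fun d => .inl (C.α (C.σ d.1)))
  left_inv := by
    have hφ : ∀ d, C.α (C.σ (C.φ d)) = d := fun d => by rw [σ_φ, C.α_α]
    rintro (d | ⟨d, hd⟩)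
    · by_cases h : C.col (C.φ d) = κ.swap <;> simp [h, hφ]
    · simp [hd]
  right_inv := by
    rintro (d | ⟨d, hd⟩)
    · by_cases h : C.col d = κ.swap <;> simp [h, φ_α_σ]
    · simp [φ_α_σ, hd]

/-- Reversal: the dual dart of the reversed dart, or the opposite corner. -/
def decodingReversal (κ : Kind) : Perm (C.DecodingDart κ) where
  toFun := Sum.map C.α
    (fun d => ⟨C.σ (C.σ d.1), by rw [col_σ, col_σ, Kind_swap_swap, d.2]⟩)
  invFun := Sum.map C.α
    (fun d => ⟨C.σ (C.σ d.1), by rw [col_σ, col_σ, Kind_swap_swap, d.2]⟩)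
  left_inv := by
    rintro (d | ⟨d, hd⟩)
    · simp [C.α_α]
    · simp [(C.σ_pow_four d).1]
  right_inv := by
    rintro (d | ⟨d, hd⟩)
    · simp [C.α_α]
    · simp [(C.σ_pow_four d).1]

/-- The triangle of type `κ` on the left of a dart of the decoding graph. -/
def decodingFace (κ : Kind) : C.DecodingDart κ → {d : D // C.col d = κ} :=
  Sum.elim
    (fun d => if h : C.col d = κ then ⟨C.α d, by rw [col_α, h]⟩
      else ⟨C.φ d, by rw [col_φ, (Kind.eq_swap_iff κ (C.col d)).2 (Ne.symm h)]⟩)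
    (fun d => ⟨C.σ⁻¹ d.1, by
      have h := C.col_σ (C.σ⁻¹ d.1)
      rw [← Perm.mul_apply, mul_inv_cancel, Perm.one_apply, d.2] at h
      simpa only [Kind_swap_swap] using (congrArg Kind.swap h).symm⟩)

theorem decodingRotation_inl_φ (κ : Kind) (d : D) :
    (C.decodingRotation κ).SameCycle (.inl d) (.inl (C.φ d)) := by
  by_cases h : C.col (C.φ d) = κ.swap
  · exact ⟨2, by simp [decodingRotation, h, zpow_ofNat, pow_succ]⟩
  · exact ⟨1, by simp [decodingRotation, h]⟩

theorem decodingRotation_sameCycle (κ : Kind) {d d' : D} (h : C.face d = C.face d') :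
    (C.decodingRotation κ).SameCycle (.inl d) (.inl d') := by
  let r : Setoid D := Setoid.comap Sum.inl (Perm.SameCycle.setoid (C.decodingRotation κ))
  have := eq_of_sameCycle (π := C.φ) (h := fun d => (Quotient.mk r d))
    (fun d => Quotient.sound (C.decodingRotation_inl_φ κ d).symm) ((C.face_eq_iff _ _).1 h)
  exact Quotient.exact this

theorem decodingFace_inl (κ : Kind) (d : D) (h : C.col d = κ) :
    (C.decodingFace κ (.inl d)).1 = C.α d := by simp [decodingFace, h]

theorem decodingFace_inl' (κ : Kind) (d : D) (h : C.col d ≠ κ) :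
    (C.decodingFace κ (.inl d)).1 = C.φ d := by simp [decodingFace, h]

theorem decodingFace_inr (κ : Kind) (d) :
    (C.decodingFace κ (.inr d)).1 = C.σ⁻¹ d.1 := rfl

theorem decodingφ_inl (κ : Kind) (d : D) (h : C.col d = κ) :
    ((C.decodingRotation κ)⁻¹ * C.decodingReversal κ) (.inl d) =
      .inl (C.α (C.σ (C.α d))) := by
  rw [Perm.mul_apply, Perm.inv_eq_iff_eq]
  have : C.col d ≠ κ.swap := by subst h; cases C.col d <;> simp [Kind.swap]
  simp [decodingRotation, decodingReversal, φ_α_σ, col_α, this]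

theorem decodingφ_inl' (κ : Kind) (d : D) (h : C.col d = κ.swap) :
    ((C.decodingRotation κ)⁻¹ * C.decodingReversal κ) (.inl d) =
      .inr ⟨C.α d, by rw [col_α, h]⟩ := by
  rw [Perm.mul_apply, Perm.inv_eq_iff_eq]
  simp [decodingRotation, decodingReversal]

theorem σ_inv (d : D) : C.σ⁻¹ d = C.σ (C.σ (C.σ d)) := by
  rw [Perm.inv_eq_iff_eq]; exact (C.σ_pow_four d).1.symm

theorem decodingφ_inr (κ : Kind) (d : {d : D // C.col d = κ.swap}) :
    ((C.decodingRotation κ)⁻¹ * C.decodingReversal κ) (.inr d) =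
      .inl (C.α (C.σ⁻¹ d.1)) := by
  rw [Perm.mul_apply, Perm.inv_eq_iff_eq]
  have h : C.col (C.σ (C.σ d.1)) = κ.swap := by rw [col_σ, col_σ, Kind_swap_swap, d.2]
  have h' : C.φ (C.α (C.σ⁻¹ d.1)) = C.σ (C.σ d.1) := by rw [σ_inv, φ_α_σ]
  simp only [decodingRotation, decodingReversal, coe_fn_mk, Sum.elim_inl, Sum.map_inr, h', h,
    dite_true]

theorem decodingFace_φ (κ : Kind) (x : C.DecodingDart κ) :
    C.decodingFace κ (((C.decodingRotation κ)⁻¹ * C.decodingReversal κ) x) =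
      C.decodingFace κ x := by
  have hs : κ.swap ≠ κ := by cases κ <;> simp [Kind.swap]
  apply Subtype.ext
  rcases x with d | d
  · by_cases h : C.col d = κ
    · have h1 : C.col (C.α (C.σ (C.α d))) ≠ κ := by rw [col_α_σ, col_α, h]; exact hs
      rw [decodingφ_inl _ _ _ h, decodingFace_inl' _ _ _ h1, decodingFace_inl _ _ _ h, φ_α_σ]
    · have h1 := (Kind.eq_swap_iff (C.col d) κ).2 h
      rw [decodingφ_inl' _ _ _ h1, decodingFace_inr, decodingFace_inl' _ _ _ h]
      rfl
  · have h1 : C.col (C.α (C.σ⁻¹ d.1)) = κ := by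
      rw [σ_inv, col_α_σ, col_σ, col_σ, d.2]; simp only [Kind_swap_swap]
    rw [decodingφ_inr, decodingFace_inl _ _ _ h1, decodingFace_inr, C.α_α]

theorem decodingφ_sameCycle (κ : Kind) (x : C.DecodingDart κ) :
    ((C.decodingRotation κ)⁻¹ * C.decodingReversal κ).SameCycle x
      (.inl (C.α (C.decodingFace κ x).1)) := by
  rcases x with d | d
  · by_cases h : C.col d = κ
    · rw [decodingFace_inl _ _ _ h, C.α_α]
    · have h1 := (Kind.eq_swap_iff (C.col d) κ).2 h
      refine ⟨2, ?_⟩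
      rw [zpow_ofNat, pow_two, Perm.mul_apply, decodingφ_inl' _ _ _ h1, decodingφ_inr,
        decodingFace_inl' _ _ _ h]
      rfl
  · refine ⟨1, ?_⟩
    rw [zpow_one, decodingφ_inr, decodingFace_inr]

/-- The decoding graph for errors of type `κ` (`Γ_X` for bit flips, `Γ_Z` for phase flips).
Its vertices are the `f`-faces and its edges are the qubits: the qubit on an edge of the original
graph joins the two `f`-faces on the sides of this edge, and the qubit at a vertex joins the two
`f`-faces whose triangle at this vertex has the type opposite to `κ`. It is drawn on the
same surface, and the regions that it leaves are the triangles of type `κ`. -/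
def decodingGraph (κ : Kind) :
    EmbeddedGraph (C.DecodingDart κ) F (Qubit E V) {d : D // C.col d = κ} where
  σ := C.decodingRotation κ
  α := C.decodingReversal κ
  α_α := (C.decodingReversal κ).left_inv
  α_ne := by
    rintro (d | ⟨d, hd⟩)
    · simpa [decodingReversal] using C.α_ne d
    · simpa [decodingReversal] using (C.σ_pow_four d).2
  vert := Sum.elim C.face (fun d => C.face d.1)
  edge := Sum.map C.edge (fun d => C.vert d.1)
  face := C.decodingFace κ
  vert_surj := fun f => by
    obtain ⟨d, rfl⟩ := C.face_surj f
    exact ⟨.inl d, rfl⟩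
  edge_surj := by
    rintro (e | v)
    · obtain ⟨d, rfl⟩ := C.edge_surj e
      exact ⟨.inl d, rfl⟩
    · obtain ⟨d, rfl⟩ := C.vert_surj v
      by_cases h : C.col d = κ.swap
      · exact ⟨.inr ⟨d, h⟩, rfl⟩
      · refine ⟨.inr ⟨C.σ d, ?_⟩, ?_⟩
        · rw [col_σ, Kind.eq_of_ne_swap h]
        · simp [vert_σ]
  face_surj := fun d => ⟨.inl (C.α d.1), by
    apply Subtype.ext
    rw [decodingFace_inl _ _ _ (by rw [col_α, d.2]), C.α_α]⟩
  vert_eq_iff := fun x y => by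
    constructor
    · have aux : ∀ x : C.DecodingDart κ, ∃ d, (C.decodingRotation κ).SameCycle x (.inl d) ∧
          C.face d = Sum.elim C.face (fun d => C.face d.1) x := by
        rintro (d | d)
        · exact ⟨d, Perm.SameCycle.refl _ _, rfl⟩
        · exact ⟨d.1, ⟨1, by simp [decodingRotation]⟩, rfl⟩
      intro h
      obtain ⟨a, ha, ha'⟩ := aux x
      obtain ⟨b, hb, hb'⟩ := aux y
      exact ha.trans ((C.decodingRotation_sameCycle κ (by rw [ha', h, hb'])).trans hb.symm)
    · apply eq_of_sameCycle
      rintro (d | d)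
      · by_cases h : C.col (C.φ d) = κ.swap <;> simp [decodingRotation, h, face_φ]
      · simp [decodingRotation]
  edge_eq_iff := fun x y => by
    constructor
    · have hα : ∀ d d', C.edge d = C.edge d' → d' = d ∨ d' = C.α d := by
        intro d d' h
        obtain ⟨k, rfl⟩ := (C.edge_eq_iff _ _).1 h
        have h2 : C.α ^ (2 : ℤ) = 1 := by ext d; simp [zpow_ofNat, pow_two, C.α_α]
        rcases Int.even_or_odd' k with ⟨j, rfl | rfl⟩
        · left; rw [zpow_mul, h2]; simp
        · right; rw [zpow_add, zpow_mul, h2]; simp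
      have hσ : ∀ d d', C.vert d = C.vert d' → C.col d = κ.swap → C.col d' = κ.swap →
          d' = d ∨ d' = C.σ (C.σ d) := by
        intro d d' h hd hd'
        obtain ⟨k, rfl⟩ := (C.vert_eq_iff _ _).1 h
        have h4 : C.σ ^ (4 : ℤ) = 1 := by
          ext d; simpa [zpow_ofNat, pow_succ] using (C.σ_pow_four d).1
        have hk : C.σ ^ k = C.σ ^ (k % 4) := by
          conv_lhs => rw [← Int.emod_add_mul_ediv k 4, zpow_add, zpow_mul, h4]
          simp
        have hs : κ ≠ κ.swap := by cases κ <;> simp [Kind.swap]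
        rw [hk] at hd' ⊢
        have : k % 4 = 0 ∨ k % 4 = 1 ∨ k % 4 = 2 ∨ k % 4 = 3 := by omega
        rcases this with h | h | h | h <;> rw [h] at hd' ⊢
        · left; simp
        · rw [zpow_one, col_σ, hd, Kind_swap_swap] at hd'; exact absurd hd' hs
        · right; simp [zpow_ofNat, pow_succ]
        · have : (C.σ ^ (3 : ℤ)) d = C.σ (C.σ (C.σ d)) := by simp [zpow_ofNat, pow_succ]
          rw [this, col_σ, col_σ, col_σ, hd] at hd'
          simp only [Kind_swap_swap] at hd'
          exact absurd hd' hs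
      rcases x with d | d <;> rcases y with d' | d' <;> intro h
      · rcases hα d d' (by simpa using h) with rfl | rfl
        · exact Perm.SameCycle.refl _ _
        · exact ⟨1, by simp [decodingReversal]⟩
      · simp at h
      · simp at h
      · rcases hσ d d' (by simpa using h) d.2 d'.2 with h | h
        · rw [Subtype.ext h]
        · exact ⟨1, by simpa [decodingReversal] using Subtype.ext h.symm⟩
    · apply eq_of_sameCycle
      rintro (d | d)
      · simp [decodingReversal, edge_α]
      · simp [decodingReversal, vert_σ]
  face_eq_iff := fun x y => by
    constructor
    · intro h
      have := C.decodingφ_sameCycle κ y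
      rw [← h] at this
      exact (C.decodingφ_sameCycle κ x).trans this.symm
    · exact eq_of_sameCycle (C.decodingFace_φ κ)

section gauge

variable [Fintype D] [Fintype V] [Fintype E]

open Classical in
/-- The three qubits of the triangle at a corner. -/
noncomputable def triangle (d : D) : Qubit E V → ZMod 2 :=
  Pi.single (.inl (C.edge d)) 1 + Pi.single (.inl (C.edge (C.σ d))) 1 +
    Pi.single (.inr (C.vert d)) 1

/-- The gauge operator `X X X` or `Z Z Z` of a triangle. -/
noncomputable def gaugeOp (d : D) : Pauli (Qubit E V) := Pauli.op (C.col d) (C.triangle d)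

/-- The gauge group. -/
noncomputable def gaugeGroup : Subgroup (Pauli (Qubit E V)) := Subgroup.closure (Set.range C.gaugeOp)

open Classical in
/-- The stabilizer of type `τ` of the face `f`: the product of the gauge operators of type `τ`
along the boundary of `f`. -/
noncomputable def stabilizer (τ : Kind) (f : F) : Pauli (Qubit E V) :=
  Pauli.op τ (∑ d : D with C.face d = f ∧ C.col d = τ, C.triangle d)

/-- The errors that act trivially on the encoded information: gauge operators and scalars. -/
noncomputable def harmless : Subgroup (Pauli (Qubit E V)) := C.gaugeGroup ⊔ Subgroup.zpowers Pauli.imag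

/-- The projected syndrome: the syndrome that the error `err` leaves on the vertices of the
decoding graph for errors of type `κ`; the vertex `f` carries the outcome of the stabilizer of
`f` of the type opposite to `κ`. -/
noncomputable def projectedSyndrome (err : Pauli (Qubit E V)) (κ : Kind) (f : F) : ZMod 2 :=
  Pauli.syndrome (C.stabilizer κ.swap f) err

end gauge

end SubsystemSurfaceCode

/-- Lifting: the estimates on the two decoding graphs, which are sets of qubits, are
lifted to a product of bit flips and a product of phase flips, and these are multiplied. -/
def liftError {V E : Type} [Fintype V] [Fintype E] (y : Kind → E ⊕ V → ZMod 2) : Pauli (E ⊕ V) :=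
  Pauli.op .X (y .X) * Pauli.op .Z (y .Z)


/-! ## A machine model with a step count

A random access machine with registers and arrays of natural numbers. Programs are structured
and have bounded loops only; every elementary operation (reading a constant, a register or an
array cell, adding, subtracting, comparing with zero, writing, one round of a loop) costs one
step. There is no multiplication. A program may also call a decoder for surface codes. -/

/-- The description of a surface code and of a syndrome that a decoder receives: for each qubit,
in order, the two vertices and the two faces at its edge, and for each vertex, in order, the
syndrome bit. -/
structure SurfaceInstance where
  ends : List (ℕ × ℕ)
  sides : List (ℕ × ℕ)
  syn : List ℕ

/-- A decoder turns an instance into a list of bits, one for each qubit, and takes a number of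
steps. Nothing else is assumed about the way it works. -/
abbrev Decoder : Type := SurfaceInstance → List ℕ × ℕ

/-- The contents of the memory. -/
structure Mem where
  reg : ℕ → ℕ
  arr : ℕ → ℕ → ℕ

/-- Expressions. -/
inductive Expr : Type
  | const (k : ℕ)
  | reg (r : ℕ)
  | get (a : ℕ) (i : Expr)
  | add (s t : Expr)
  | sub (s t : Expr)

/-- The value of an expression; subtraction is truncated at zero. -/
def Expr.eval (m : Mem) : Expr → ℕ
  | .const k => k
  | .reg r => m.reg r
  | .get a i => m.arr a (i.eval m)
  | .add s t => s.eval m + t.eval m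
  | .sub s t => s.eval m - t.eval m

/-- The number of steps to evaluate an expression. -/
def Expr.cost : Expr → ℕ
  | .const _ => 1
  | .reg _ => 1
  | .get _ i => i.cost + 1
  | .add s t => s.cost + t.cost + 1
  | .sub s t => s.cost + t.cost + 1

/-- Programs. `set r e` and `put a i e` write the value of `e` into register `r` and into cell
`i` of array `a`; `ite e p q` runs `p` if `e` is not zero and `q` otherwise; `loop r e p` runs
`p` with `r` set to `0, 1, …` up to the value, at the beginning, of `e`, exclusive;
`call nV nE a b c d s out` calls the decoder on the instance with as many vertices and edges
as the registers `nV` and `nE` say, with ends in the arrays `a`, `b`, sides in the arrays `c`,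
`d` and syndrome in the array `s`, and writes the estimate into the array `out`. -/
inductive Program : Type
  | set (r : ℕ) (e : Expr)
  | put (a : ℕ) (i e : Expr)
  | seq (p q : Program)
  | ite (e : Expr) (p q : Program)
  | loop (r : ℕ) (e : Expr) (p : Program)
  | call (nV nE a b c d s out : ℕ)

/-- The instance that is stored in the given registers and arrays. -/
def Mem.instanceAt (m : Mem) (nV nE a b c d s : ℕ) : SurfaceInstance where
  ends := (List.range (m.reg nE)).map fun i => (m.arr a i, m.arr b i)
  sides := (List.range (m.reg nE)).map fun i => (m.arr c i, m.arr d i)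
  syn := (List.range (m.reg nV)).map (m.arr s)

/-- The memory after running a program with a given decoder, and the number of steps. A call
costs the time of the decoder and the size of the instance. -/
def Program.run (dec : Decoder) : Program → Mem → Mem × ℕ
  | .set r e, m => ({ m with reg := Function.update m.reg r (e.eval m) }, e.cost + 1)
  | .put a i e, m =>
      ({ m with arr := Function.update m.arr a (Function.update (m.arr a) (i.eval m) (e.eval m)) },
        i.cost + e.cost + 1)
  | .seq p q, m =>
      let u := p.run dec m
      let w := q.run dec u.1
      (w.1, u.2 + w.2)
  | .ite e p q, m =>
      let u := if e.eval m ≠ 0 then p.run dec m else q.run dec m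
      (u.1, e.cost + 1 + u.2)
  | .loop r e p, m =>
      Nat.rec (m, e.cost + 1)
        (fun i u =>
          let w := p.run dec { u.1 with reg := Function.update u.1.reg r i }
          (w.1, u.2 + w.2 + 1))
        (e.eval m)
  | .call nV nE a b c d s out, m =>
      let u := dec (m.instanceAt nV nE a b c d s)
      ({ m with arr := Function.update m.arr out fun i => u.1.getD i 0 },
        u.2 + m.reg nV + m.reg nE + 1)

/-- The memory, zero elsewhere, with an instance stored in registers `0`, `1` and arrays
`0, …, 4`. -/
def SurfaceInstance.load (I : SurfaceInstance) : Mem where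
  reg
    | 0 => I.syn.length
    | 1 => I.ends.length
    | _ => 0
  arr
    | 0 => fun i => (I.ends.getD i (0, 0)).1
    | 1 => fun i => (I.ends.getD i (0, 0)).2
    | 2 => fun i => (I.sides.getD i (0, 0)).1
    | 3 => fun i => (I.sides.getD i (0, 0)).2
    | 4 => fun i => I.syn.getD i 0
    | _ => fun _ => 0

/-- The decoder that a program of the machine itself implements: it finds the instance in the
memory and leaves the estimate in array `5`. Its own calls are answered by zeros. -/
def Program.toDecoder (S : Program) : Decoder := fun I =>
  let u := S.run (fun _ => ([], 0)) I.load
  ((List.range I.ends.length).map (u.1.arr 5), u.2)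

/-- `f` numbers the elements of a type by `0, …, n - 1`. -/
def IsNumbering {A : Type} (f : A → ℕ) (n : ℕ) : Prop :=
  Function.Injective f ∧ Set.range f = Set.Iio n

/-- The instance `I` describes the surface code of the embedded graph `M` and the syndrome `s`
on its vertices. The vertices and the edges are numbered consecutively, the faces have distinct
numbers below twice the number of edges. -/
structure SurfaceInstance.Describes {D V E F : Type} (I : SurfaceInstance)
    (M : EmbeddedGraph D V E F) (s : V → ZMod 2) (numV : V → ℕ) (numE : E → ℕ)
    (numF : F → ℕ) : Prop where
  vertices : IsNumbering numV I.syn.length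
  edges : IsNumbering numE I.ends.length
  faces : Function.Injective numF ∧ ∀ f, numF f < 2 * I.ends.length
  length_sides : I.sides.length = I.ends.length
  syndrome : ∀ v, I.syn.getD (numV v) 0 = (s v).val
  incidence : ∀ e, ∃ d, M.edge d = e ∧
    I.ends.getD (numE e) (0, 0) = (numV (M.vert d), numV (M.vert (M.α d))) ∧
    I.sides.getD (numE e) (0, 0) = (numF (M.face d), numF (M.face (M.α d)))

/-- The set of qubits that a list of numbers, read modulo 2, stands for. -/
def readOff {A : Type} (f : A → ℕ) (y : ℕ → ℕ) (a : A) : ZMod 2 := (y (f a) : ZMod 2)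

/-- A decoder for surface codes: for every surface code on a connected closed oriented surface
and every syndrome that some error causes, its estimate has this syndrome. -/
def IsSurfaceDecoder (dec : Decoder) : Prop :=
  ∀ (D V E F : Type) [Fintype D] [Fintype E] (M : EmbeddedGraph D V E F),
    M.Connected → ∀ (I : SurfaceInstance) (numV : V → ℕ) (numE : E → ℕ) (numF : F → ℕ)
      (x : E → ZMod 2), I.Describes M (M.boundary x) numV numE numF →
        M.boundary (readOff numE fun i => (dec I).1.getD i 0) = M.boundary x

/-- The number of a qubit: first the edges, then the vertices. -/
def qubitNumber {V E : Type} [Fintype E] (numV : V → ℕ) (numE : E → ℕ) : E ⊕ V → ℕ :=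
  Sum.elim numE fun v => Fintype.card E + numV v

/-- The input of the decoding program for subsystem surface codes: the graph and the colouring
(a triangle of type `Z` is marked by `1`) in arrays `0, …, 5`, the measured syndromes of the
`X`-type and the `Z`-type stabilizers in arrays `6` and `7`. The rest of the memory is
arbitrary. -/
structure Mem.Holds {D V E F : Type} (m : Mem) (C : SubsystemSurfaceCode D V E F)
    (s : Kind → F → ZMod 2) (numD : D → ℕ) (numV : V → ℕ) (numE : E → ℕ) (numF : F → ℕ) :
    Prop where
  darts : IsNumbering numD (m.reg 0)
  vertices : IsNumbering numV (m.reg 1)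
  edges : IsNumbering numE (m.reg 2)
  faces : IsNumbering numF (m.reg 3)
  rotation : ∀ d, m.arr 0 (numD d) = numD (C.σ d)
  reversal : ∀ d, m.arr 1 (numD d) = numD (C.α d)
  vert : ∀ d, m.arr 2 (numD d) = numV (C.vert d)
  edge : ∀ d, m.arr 3 (numD d) = numE (C.edge d)
  face : ∀ d, m.arr 4 (numD d) = numF (C.face d)
  colour : ∀ d, m.arr 5 (numD d) = if C.col d = .Z then 1 else 0
  synX : ∀ f, m.arr 6 (numF f) = (s .X f).val
  synZ : ∀ f, m.arr 7 (numF f) = (s .Z f).val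

/-- The array in which the decoding program leaves the estimate of the errors of type `κ`. -/
def outArray : Kind → ℕ
  | .X => 8
  | .Z => 9

/-! ## Pauli operators: parts, syndromes and subgroups -/

namespace Pauli

variable {Q : Type}

/-! The theorem rests on a dictionary between the gauge code and the two graphs $\Gamma_\kappa$.
Colours alternate around a face, so each edge side of $f$ lies in exactly one corner of $f$ of type
$\bar\kappa$; hence the star of $f$ in $\Gamma_\kappa$ is the sum of the $\bar\kappa$-triangles of
$f$ (`star_decodingGraph`). A $\kappa$-triangle has exactly three darts of $\Gamma_\kappa$ with it
on the left, one per qubit (`plaquette_decodingGraph`). With $|F|$ vertices, $|E|+|V|$ edges and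
$|D|/2=2|V|$ faces, the Euler characteristic is unchanged.

The rest of the algebra is $\mathbb F_2$-homology. An operator of one type only detects the other
type, and pairing with a star is the boundary map (`sum_star_mul`), so syndromes are boundaries of
the parts of an error. Checks commute with gauge operators because the boundary of a plaquette
vanishes. Being harmless, and being a surface-code stabilizer of type $\kappa$, both mean that the
$\kappa$-part lies in the span of the plaquettes of $\Gamma_\kappa$ (`mem_harmless_iff`,
`op_mem_surfaceStabilizer_iff`).

The decoding program builds each $\Gamma_\kappa$ in one pass over the darts; since $|D|=2|E|=4|V|$,
this is linear in $n$ (`decodePart_meets`).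

The explicit surface decoder needs no matching, only some error with the given boundary. It removes
edges in decreasing order and keeps the residual syndrome even on every component formed by the
remaining edges. This holds at the start because the syndrome is a boundary (`classSum_boundary`).
Removing an edge either leaves the components alone or splits one in two; in the second case the two
parities agree, and flipping the edge when they are odd repairs both (`classSum_update`). When no
edge is left the components are single vertices, so the residual is zero. -/

theorem sgn_injective : Function.Injective sgn := by decide

theorem part_op_self (κ : Kind) (y : Q → ZMod 2) : (op κ y).part κ = y := by
  cases κ <;> rfl

theorem part_op_swap (κ : Kind) (y : Q → ZMod 2) : (op κ.swap y).part κ = 0 := by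
  cases κ <;> rfl

theorem part_op_of_ne {κ τ : Kind} (h : τ ≠ κ) (y : Q → ZMod 2) : (op τ y).part κ = 0 := by
  rw [(Kind.eq_swap_iff τ κ).2 h, part_op_swap]

theorem op_zero (κ : Kind) : op κ (0 : Q → ZMod 2) = 1 := by
  cases κ <;> rfl

theorem op_neg (κ : Kind) (y : Q → ZMod 2) : op κ (-y) = op κ y := by
  congr 1
  funext q
  exact ZMod.neg_eq_self_mod_two _

theorem part_one (κ : Kind) : (1 : Pauli Q).part κ = 0 := by cases κ <;> rfl

theorem part_imag (κ : Kind) : (imag : Pauli Q).part κ = 0 := by cases κ <;> rfl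

variable [Fintype Q]

theorem part_mul (κ : Kind) (a b : Pauli Q) : (a * b).part κ = a.part κ + b.part κ := by
  cases κ <;> rfl

theorem part_inv (κ : Kind) (a : Pauli Q) : a⁻¹.part κ = a.part κ := by cases κ <;> rfl

/-- The two products can differ only in the phase, through the signs from moving $Z$ past $X$, and
`sgn` loses nothing. -/
theorem commute_iff (a b : Pauli Q) :
    Commute a b ↔ ∑ q, a.z q * b.x q = ∑ q, b.z q * a.x q := by
  rw [commute_iff_eq, mul_def, mul_def, Pauli.mk.injEq, add_comm b.phase, add_comm b.x,
    add_comm b.z]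
  simp only [add_right_inj, and_true]
  exact sgn_injective.eq_iff

theorem commute_op_op_self (κ : Kind) (y y' : Q → ZMod 2) : Commute (op κ y) (op κ y') := by
  rw [commute_iff]
  cases κ <;> simp [op]

/-- The decoupling of the two error types: one of the two terms of the symplectic form vanishes for
an operator of a single type. -/
theorem commute_op_swap_iff (κ : Kind) (y : Q → ZMod 2) (P : Pauli Q) :
    Commute (op κ.swap y) P ↔ ∑ q, y q * P.part κ q = 0 := by
  rw [commute_iff]
  cases κ
  · simp [op, Kind.swap, part]
  · simp only [op, Kind.swap, part, Pi.zero_apply, zero_mul, Finset.sum_const_zero]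
    rw [eq_comm]
    simp only [mul_comm]

theorem syndrome_op_swap (κ : Kind) (y : Q → ZMod 2) (P : Pauli Q) :
    syndrome (op κ.swap y) P = ∑ q, y q * P.part κ q := by
  classical
  have h2 : ∀ t : ZMod 2, (if t = 0 then 0 else 1) = t := by decide
  rw [syndrome, ← h2 (∑ q, y q * P.part κ q)]
  exact if_congr (commute_op_swap_iff κ y P) rfl rfl

/-- Operators of one type multiply without signs, so spans of vectors pass to subgroups with no
phase to correct. -/
theorem op_mem_of_mem_closure {κ : Kind} {A : Set (Q → ZMod 2)} {S : Subgroup (Pauli Q)}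
    (h : ∀ a ∈ A, op κ a ∈ S) {y : Q → ZMod 2} (hy : y ∈ AddSubgroup.closure A) : op κ y ∈ S := by
  induction hy using AddSubgroup.closure_induction with
  | mem a ha => exact h a ha
  | zero => rw [op_zero]; exact S.one_mem
  | add a b _ _ ha hb => rw [op_add]; exact S.mul_mem ha hb
  | neg a _ ha => rwa [op_neg]

/-- The operators whose part of type `κ` lies in a given group of vectors. -/
def partComap (κ : Kind) (T : AddSubgroup (Q → ZMod 2)) : Subgroup (Pauli Q) where
  carrier := {P | P.part κ ∈ T}
  one_mem' := by simp only [Set.mem_ofPred_eq, part_one]; exact T.zero_mem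
  mul_mem' := fun ha hb => by
    simp only [Set.mem_ofPred_eq, part_mul] at *; exact T.add_mem ha hb
  inv_mem' := fun ha => by simpa only [Set.mem_ofPred_eq, part_inv] using ha

theorem mem_partComap {κ : Kind} {T : AddSubgroup (Q → ZMod 2)} {P : Pauli Q} :
    P ∈ partComap κ T ↔ P.part κ ∈ T := Iff.rfl

theorem imag_pow (k : ℕ) : (imag : Pauli Q) ^ k = ⟨k, 0, 0⟩ := by
  induction k with
  | zero => simp [one_def]
  | succ k ih => rw [pow_succ, ih]; simp [imag, mul_def, sgn_zero]

theorem imag_pow_mul (k : ℕ) (P : Pauli Q) : imag ^ k * P = ⟨k + P.phase, P.x, P.z⟩ := by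
  rw [imag_pow]; simp [mul_def, sgn_zero]

end Pauli

/-! ### Lifting pairs of qubit sets to Pauli errors -/

section lift

variable {V E : Type} [Fintype V] [Fintype E]

theorem part_liftError (y : Kind → E ⊕ V → ZMod 2) (κ : Kind) : (liftError y).part κ = y κ := by
  rw [liftError, Pauli.part_mul]
  cases κ <;> simp [Pauli.op, Pauli.part]

theorem eq_imag_pow_mul_liftError (P : Pauli (E ⊕ V)) :
    P = Pauli.imag ^ P.phase.val * liftError P.part := by
  rw [Pauli.imag_pow_mul]
  ext <;> simp [liftError, Pauli.mul_def, Pauli.op, Pauli.part, Pauli.sgn_zero]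

/-- Existence is the normal form of a Pauli operator; uniqueness holds because scalars do not affect
the parts. -/
theorem existsUnique_lift (P : Pauli (E ⊕ V)) :
    ∃! y : Kind → E ⊕ V → ZMod 2, ∃ k : ℕ, P = Pauli.imag ^ k * liftError y := by
  refine ⟨P.part, ⟨_, eq_imag_pow_mul_liftError P⟩, ?_⟩
  rintro y ⟨k, rfl⟩
  funext κ
  rw [← part_liftError y κ, Pauli.imag_pow_mul]
  cases κ <;> rfl

end lift

/-! ## Stars, plaquettes and boundaries -/

namespace EmbeddedGraph

variable {D V E F : Type} (M : EmbeddedGraph D V E F)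

theorem vert_σ (d : D) : M.vert (M.σ d) = M.vert d :=
  ((M.vert_eq_iff _ _).2 ⟨1, by simp⟩).symm

theorem edge_α (d : D) : M.edge (M.α d) = M.edge d :=
  ((M.edge_eq_iff _ _).2 ⟨1, by simp⟩).symm

/-- The face on the left of a dart is on the right of the next dart at its tail: both bound the same
corner. -/
theorem face_α_σ (d : D) : M.face (M.α (M.σ d)) = M.face d :=
  (M.face_eq_iff _ _).2 ⟨1, by simp [Perm.mul_apply, M.α_α]⟩

theorem edge_eq_edge_iff (d d' : D) : M.edge d = M.edge d' ↔ d' = d ∨ d' = M.α d := by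
  constructor
  · intro h
    obtain ⟨k, rfl⟩ := (M.edge_eq_iff _ _).1 h
    have h2 : M.α ^ (2 : ℤ) = 1 := by ext d; simp [zpow_ofNat, pow_two, M.α_α]
    rcases Int.even_or_odd' k with ⟨j, rfl | rfl⟩
    · left; rw [zpow_mul, h2]; simp
    · right; rw [zpow_add, zpow_mul, h2]; simp
  · rintro (rfl | rfl)
    · rfl
    · exact (M.edge_α d).symm

variable [Fintype D]

theorem sum_edge_eq [DecidableEq E] {A : Type} [AddCommMonoid A] (d : D) (h : D → A) :
    ∑ d' with M.edge d' = M.edge d, h d' = h d + h (M.α d) := by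
  classical
  have : ({d' | M.edge d' = M.edge d} : Finset D) = {d, M.α d} := by
    ext d'
    rw [Finset.mem_filter_univ, eq_comm, M.edge_eq_edge_iff]; simp
  rw [this, Finset.sum_pair (M.α_ne d).symm]

/-- The relation $\partial\partial=0$. Around `v`, the darts with `f` on the left and those with `f`
on the right correspond through rotation by one corner, so they cancel modulo 2. -/
theorem boundary_plaquette (v : V) (f : F) : M.boundary (M.plaquette f) v = 0 := by
  classical
  simp only [boundary, plaquette, Finset.sum_apply, Pi.single_apply]
  -- The plaquette evaluated on an edge counts the sides of that edge lying in `f`, zero, one or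
  -- two.
  have h1 : ∀ d : D, (∑ d' with M.face d' = f, if M.edge d = M.edge d' then (1 : ZMod 2) else 0) =
      (if M.face d = f then 1 else 0) + if M.face (M.α d) = f then 1 else 0 := by
    intro d
    rw [← M.sum_edge_eq d fun d' => if M.face d' = f then (1 : ZMod 2) else 0,
      Finset.sum_filter, Finset.sum_filter]
    refine Finset.sum_congr rfl fun d' _ => ?_
    by_cases h : M.edge d = M.edge d' <;> simp [h, eq_comm]
  have h2 : (∑ d with M.vert d = v, if M.face (M.α d) = f then (1 : ZMod 2) else 0) =
      ∑ d with M.vert d = v, if M.face d = f then (1 : ZMod 2) else 0 := by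
    rw [Finset.sum_filter, Finset.sum_filter, ← Equiv.sum_comp M.σ]
    simp only [vert_σ, face_α_σ]
  have h3 : ∀ t : ZMod 2, t + t = 0 := by decide
  convert (?_ : ∑ d with M.vert d = v, ((if M.face d = f then (1 : ZMod 2) else 0) +
    if M.face (M.α d) = f then 1 else 0) = 0) using 1
  · exact Finset.sum_congr (by congr) fun d _ => h1 d
  · rw [Finset.sum_add_distrib, h2, h3]

variable [Fintype E]

theorem card_dart_eq_two_mul_card_edge (M : EmbeddedGraph D V E F) :
    Fintype.card D = 2 * Fintype.card E := by
  classical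
  have h := Finset.card_eq_sum_card_fiberwise (s := (Finset.univ : Finset D)) (t := Finset.univ)
    (f := M.edge) (fun _ _ => Finset.mem_coe.2 (Finset.mem_univ _))
  rw [Finset.card_univ] at h
  rw [h, Finset.sum_const_nat (m := 2), mul_comm, Finset.card_univ]
  intro e _
  obtain ⟨d, rfl⟩ := M.edge_surj e
  rw [Finset.card_eq_sum_ones, M.sum_edge_eq]

/-- Turns the symplectic pairing with a vertex operator into a boundary, so that syndromes become
homological. -/
theorem sum_star_mul (v : V) (y : E → ZMod 2) : ∑ e, M.star v e * y e = M.boundary y v := by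
  classical
  simp only [star, boundary, Finset.sum_apply, Finset.sum_mul]
  rw [Finset.sum_comm]
  refine Finset.sum_congr (by congr) fun d _ => ?_
  rw [Finset.sum_eq_single (M.edge d)]
  · simp
  · intro e _ he; simp [he]
  · simp

end EmbeddedGraph

/-! ## The decoding graphs -/

namespace SubsystemSurfaceCode

variable {D V E F : Type} (C : SubsystemSurfaceCode D V E F)

theorem swap_ne (κ : Kind) : κ.swap ≠ κ := by cases κ <;> simp [Kind.swap]

/-- One or two steps of the new rotation realise `φ`, and reversal realises `α`; these two generate
the connectivity of the original graph. Each corner dart is one rotation step away from an edge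
dart. -/
theorem decodingGraph_connected {C : SubsystemSurfaceCode D V E F} (h : C.Connected) (κ : Kind) :
    (C.decodingGraph κ).Connected := by
  obtain ⟨⟨d₀⟩, h⟩ := h
  refine ⟨⟨.inl d₀⟩, ?_⟩
  set r := Relation.EqvGen fun a b : C.DecodingDart κ =>
    b = (C.decodingGraph κ).σ a ∨ b = (C.decodingGraph κ).α a with hr
  have hσ : ∀ a, r a (C.decodingRotation κ a) := fun a => .rel _ _ (.inl rfl)
  have hα : ∀ d, r (.inl d) (.inl (C.α d)) := fun d => .rel _ _ (.inr rfl)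
  have hφ : ∀ d, r (.inl d) (.inl (C.φ d)) := by
    intro d
    by_cases hd : C.col (C.φ d) = κ.swap
    · refine .trans _ (.inr ⟨C.φ d, hd⟩) _ ?_ (hσ (.inr ⟨C.φ d, hd⟩))
      simpa [decodingRotation, hd] using hσ (.inl d)
    · simpa [decodingRotation, hd] using hσ (.inl d)
  have hinl : ∀ d d', r (.inl d) (.inl d') := by
    intro d d'
    induction h d d' with
    | rel a b hab =>
      rcases hab with rfl | rfl
      · refine .symm _ _ (.trans _ _ _ (hα (C.σ a)) ?_)
        simpa only [C.φ_α_σ] using hφ (C.α (C.σ a))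
      · exact hα a
    | refl a => exact .refl _
    | symm a b _ ih => exact .symm _ _ ih
    | trans a b c _ _ ih ih' => exact .trans _ _ _ ih ih'
  have hex : ∀ x : C.DecodingDart κ, ∃ d, r x (.inl d) := by
    rintro (d | d)
    · exact ⟨d, .refl _⟩
    · exact ⟨d.1, hσ (.inr d)⟩
  intro x y
  obtain ⟨a, ha⟩ := hex x
  obtain ⟨b, hb⟩ := hex y
  exact .trans _ _ _ ha (.trans _ _ _ (hinl a b) (.symm _ _ hb))

/-- The two candidates have opposite colours, and each branch of `decodingFace` is injective, so the
colour of `d` decides which one is possible. -/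
theorem decodingFace_inl_eq_iff {κ : Kind} (d : D) (t : {d : D // C.col d = κ}) :
    C.decodingFace κ (.inl d) = t ↔ d = C.α t.1 ∨ d = C.α (C.σ t.1) := by
  obtain ⟨t, rfl⟩ := t
  rw [Subtype.ext_iff]
  have hα : ∀ a b, C.α a = b ↔ a = C.α b := fun a b => by
    constructor <;> (rintro rfl; rw [C.α_α])
  have hφ : ∀ a b, C.φ a = b ↔ a = C.α (C.σ b) := fun a b => by
    rw [← hα, ← C.σ_φ, C.σ.apply_eq_iff_eq]
  by_cases h : C.col d = C.col t
  · rw [C.decodingFace_inl _ _ h, hα, or_iff_left]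
    rintro rfl
    rw [col_α_σ] at h
    exact swap_ne _ h
  · rw [C.decodingFace_inl' _ _ h, hφ, or_iff_right]
    rintro rfl
    exact h (C.col_α t)

open Classical in
/-- The set that consists of one qubit. -/
noncomputable def qubitVec (q : Qubit E V) : Qubit E V → ZMod 2 := Pi.single q 1

theorem triangle_eq (d : D) : C.triangle d =
    qubitVec (.inl (C.edge d)) + qubitVec (.inl (C.edge (C.σ d))) + qubitVec (.inr (C.vert d)) := by
  unfold triangle qubitVec
  congr!

/-! ### Dart counts and the genus of the decoding graphs -/

section counting

variable [Fintype D]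

theorem card_dart_eq_four_mul_card_vert [Fintype V] (C : SubsystemSurfaceCode D V E F) :
    Fintype.card D = 4 * Fintype.card V := by
  classical
  have h := Finset.card_eq_sum_card_fiberwise (s := (Finset.univ : Finset D)) (t := Finset.univ)
    (f := C.vert) (fun _ _ => Finset.mem_coe.2 (Finset.mem_univ _))
  rw [Finset.card_univ] at h
  rw [h, Finset.sum_const_nat (m := 4), mul_comm, Finset.card_univ]
  intro v _
  rw [← C.four_valent v, Nat.card_eq_fintype_card, Fintype.card_subtype]

/-- Rotation about a vertex exchanges the two colours. -/
theorem card_dart_eq_two_mul_card_col (κ : Kind) :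
    Fintype.card D = 2 * Fintype.card {d : D // C.col d = κ} := by
  have h1 : Fintype.card {d : D // ¬ C.col d = κ} = Fintype.card {d : D // C.col d = κ} := by
    refine Fintype.card_congr (C.σ.subtypeEquiv fun d => ?_)
    rw [col_σ]
    cases C.col d <;> cases κ <;> simp [Kind.swap]
  have h2 := Fintype.card_subtype_compl fun d : D => C.col d = κ
  have h3 := Fintype.card_subtype_le fun d : D => C.col d = κ
  omega

theorem decodingGraph_hasGenus [Fintype V] [Fintype E] [Fintype F] {g : ℕ} (h : C.HasGenus g)
    (κ : Kind) : (C.decodingGraph κ).HasGenus g := by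
  refine ⟨decodingGraph_connected h.1 κ, ?_⟩
  rw [← h.2]
  have h1 := C.card_dart_eq_four_mul_card_vert
  have h2 := C.card_dart_eq_two_mul_card_col κ
  rw [Fintype.card_sum]
  push_cast
  omega

end counting

/-! ### Checks and gauge operators as vertex and face operators -/

section gauge

variable [Fintype D]

theorem sum_decodingDart {A : Type} [AddCommMonoid A] (κ : Kind) (h : C.DecodingDart κ → A) :
    ∑ x, h x = ∑ d, h (.inl d) + ∑ d : {d : D // C.col d = κ.swap}, h (.inr d) :=
  Fintype.sum_sum_type h

open Classical in
-- Along the boundary of `f` every second corner has type `κ.swap`. The first edges of these corners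
-- are half of the boundary steps, and their second edges are the other half.
theorem star_decodingGraph (κ : Kind) (f : F) :
    (C.decodingGraph κ).star f = ∑ d : D with C.face d = f ∧ C.col d = κ.swap, C.triangle d := by
  have h1 : (∑ d : D with C.face d = f ∧ C.col d = κ.swap,
      (qubitVec (.inl (C.edge (C.σ d))) : Qubit E V → ZMod 2)) =
      ∑ d : D with C.face d = f ∧ C.col d ≠ κ.swap, qubitVec (.inl (C.edge d)) := by
    -- Shifting by one step of the face walk flips the colour and turns second edges into first
    -- edges.
    rw [Finset.sum_filter, Finset.sum_filter, ← Equiv.sum_comp C.φ]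
    refine Finset.sum_congr rfl fun d _ => ?_
    rw [face_φ, col_φ, σ_φ, edge_α]
    have : (C.col d).swap = κ.swap ↔ C.col d ≠ κ.swap := by
      cases C.col d <;> cases κ <;> simp [Kind.swap]
    simp only [this]
  simp only [EmbeddedGraph.star, triangle_eq, Finset.sum_add_distrib, h1]
  rw [Finset.sum_filter, sum_decodingDart]
  congr 1
  · rw [← Finset.sum_filter, ← Finset.sum_filter_add_sum_filter_not _ fun d => C.col d = κ.swap,
      Finset.filter_filter, Finset.filter_filter]
    congr! 3 <;> (unfold qubitVec decodingGraph; simp only [Sum.map_inl]; congr!)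
  · rw [← Finset.filter_filter, Finset.filter_comm, Finset.sum_filter,
      Finset.sum_subtype _ (p := fun d => C.col d = κ.swap) (by simp)]
    congr! 3; (unfold qubitVec decodingGraph; simp only [Sum.map_inr]; congr!)

theorem plaquette_decodingGraph (κ : Kind) (t : {d : D // C.col d = κ}) :
    (C.decodingGraph κ).plaquette t = C.triangle t.1 := by
  classical
  have hσ : C.col (C.σ t.1) = κ.swap := by rw [col_σ, t.2]
  -- The colours separate these two darts; the third dart around the triangle is the corner dart at
  -- `σ t`.
  have hne : C.α t.1 ≠ C.α (C.σ t.1) := fun h => by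
    have := congrArg C.col (C.α.injective h)
    rw [col_σ] at this
    exact swap_ne _ this.symm
  have h1 : ∀ d : {d : D // C.col d = κ.swap},
      (C.decodingGraph κ).face (.inr d) = t ↔ d = ⟨C.σ t.1, hσ⟩ := fun d => by
    rw [Subtype.ext_iff, Subtype.ext_iff]
    exact Perm.inv_eq_iff_eq
  have h2 : ∀ d : D, (C.decodingGraph κ).face (.inl d) = t ↔ d ∈ ({C.α t.1, C.α (C.σ t.1)} : Finset D) :=
    fun d => by rw [Finset.mem_insert, Finset.mem_singleton]; exact C.decodingFace_inl_eq_iff d t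
  rw [EmbeddedGraph.plaquette, Finset.sum_filter, sum_decodingDart, triangle_eq]
  simp only [h1, h2]
  rw [Fintype.sum_ite_eq', Fintype.sum_ite_mem, Finset.sum_pair hne]
  simp only [qubitVec, decodingGraph, Sum.map_inl, Sum.map_inr, edge_α, vert_σ]
  congr!

theorem stabilizer_eq (κ : Kind) (f : F) :
    C.stabilizer κ.swap f = Pauli.op κ.swap ((C.decodingGraph κ).star f) := by
  rw [star_decodingGraph]; rfl

theorem gaugeOp_eq (κ : Kind) (d : {d : D // C.col d = κ}) :
    C.gaugeOp d.1 = Pauli.op κ ((C.decodingGraph κ).plaquette d) := by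
  rw [plaquette_decodingGraph, gaugeOp, d.2]

variable [Fintype V] [Fintype E]

theorem stabilizer_mem_gaugeGroup (τ : Kind) (f : F) : C.stabilizer τ f ∈ C.gaugeGroup := by
  classical
  refine Pauli.op_mem_of_mem_closure (A := C.triangle '' {d | C.col d = τ}) ?_ ?_
  · rintro _ ⟨d, rfl, rfl⟩
    exact Subgroup.subset_closure ⟨d, rfl⟩
  · refine sum_mem fun d hd => AddSubgroup.subset_closure ⟨d, ?_, rfl⟩
    exact (Finset.mem_filter.1 hd).2.2

/-- Only a generator of the opposite type matters. On the decoding graph for the colour of that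
generator it is a face operator and the check a vertex operator, so $\partial\partial=0$ applies. -/
theorem commute_stabilizer (τ : Kind) (f : F) {h : Pauli (Qubit E V)} (hh : h ∈ C.gaugeGroup) :
    Commute h (C.stabilizer τ f) := by
  induction hh using Subgroup.closure_induction with
  | one => exact Commute.one_left _
  | mul a b _ _ ha hb => exact ha.mul_left hb
  | inv a _ ha => exact ha.inv_left
  | mem a ha =>
    obtain ⟨d, rfl⟩ := ha
    by_cases hd : C.col d = τ
    · rw [gaugeOp, hd]; exact Pauli.commute_op_op_self _ _ _
    · have hτ : τ = (C.col d).swap := (Kind.eq_swap_iff _ _).2 (Ne.symm hd)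
      subst hτ
      rw [stabilizer_eq, C.gaugeOp_eq _ ⟨d, rfl⟩]
      refine ((Pauli.commute_op_swap_iff _ _ _).2 ?_).symm
      rw [Pauli.part_op_self, EmbeddedGraph.sum_star_mul, EmbeddedGraph.boundary_plaquette]

theorem syndrome_op_star (P : Pauli (Qubit E V)) (κ : Kind) (f : F) :
    Pauli.syndrome (Pauli.op κ.swap ((C.decodingGraph κ).star f)) P =
      (C.decodingGraph κ).boundary (P.part κ) f := by
  rw [Pauli.syndrome_op_swap, EmbeddedGraph.sum_star_mul]

theorem projectedSyndrome_eq (P : Pauli (Qubit E V)) (κ : Kind) :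
    C.projectedSyndrome P κ = (C.decodingGraph κ).boundary (P.part κ) := by
  funext f
  rw [projectedSyndrome, stabilizer_eq, syndrome_op_star]

theorem syndrome_liftError (err : Pauli (E ⊕ V)) (y : Kind → E ⊕ V → ZMod 2)
    (h : ∀ κ, (C.decodingGraph κ).boundary (y κ) = C.projectedSyndrome err κ) (τ : Kind) (f : F) :
    Pauli.syndrome (C.stabilizer τ f) (liftError y) = Pauli.syndrome (C.stabilizer τ f) err := by
  have h1 := congrFun (h τ.swap) f
  have h2 := congrFun (C.projectedSyndrome_eq (liftError y) τ.swap) f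
  rw [part_liftError, h1] at h2
  simpa only [projectedSyndrome, Kind_swap_swap] using h2

/-- The generators have a pure type and all scalars are included, so membership can be tested on the
two parts separately. -/
theorem mem_harmless_iff (P : Pauli (Qubit E V)) :
    P ∈ C.harmless ↔
      ∀ κ, P.part κ ∈ AddSubgroup.closure (Set.range (C.decodingGraph κ).plaquette) := by
  constructor
  · intro h κ
    rw [← Pauli.mem_partComap]
    refine (sup_le ?_ ?_ : C.harmless ≤ _) h
    · rw [gaugeGroup, Subgroup.closure_le]
      rintro _ ⟨d, rfl⟩
      rw [SetLike.mem_coe, Pauli.mem_partComap]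
      by_cases hd : C.col d = κ
      · rw [C.gaugeOp_eq κ ⟨d, hd⟩, Pauli.part_op_self]
        exact AddSubgroup.subset_closure ⟨_, rfl⟩
      · rw [gaugeOp, Pauli.part_op_of_ne hd]
        exact zero_mem _
    · rw [Subgroup.zpowers_le, Pauli.mem_partComap, Pauli.part_imag]
      exact zero_mem _
  · intro h
    rw [eq_imag_pow_mul_liftError P]
    have hop : ∀ κ, Pauli.op κ (P.part κ) ∈ C.gaugeGroup := by
      intro κ
      refine Pauli.op_mem_of_mem_closure ?_ (h κ)
      rintro _ ⟨d, rfl⟩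
      rw [← C.gaugeOp_eq κ d]
      exact Subgroup.subset_closure ⟨_, rfl⟩
    refine mul_mem (Subgroup.mem_sup_right (pow_mem (Subgroup.mem_zpowers _) _))
      (Subgroup.mem_sup_left (mul_mem (hop .X) (hop .Z)))

/-- Vertex operators have no part of type `κ`, hence they add nothing to the span of the plaquettes.
-/
theorem op_mem_surfaceStabilizer_iff (κ : Kind) (y : Qubit E V → ZMod 2) :
    Pauli.op κ y ∈ (C.decodingGraph κ).surfaceStabilizer κ.swap ↔
      y ∈ AddSubgroup.closure (Set.range (C.decodingGraph κ).plaquette) := by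
  constructor
  · intro h
    rw [← Pauli.part_op_self κ y, ← Pauli.mem_partComap]
    refine (Subgroup.closure_le _).2 ?_ h
    rintro _ (⟨f, rfl⟩ | ⟨d, rfl⟩)
    · rw [SetLike.mem_coe, Pauli.mem_partComap]
      simp only [Pauli.part_op_swap, zero_mem]
    · rw [SetLike.mem_coe, Pauli.mem_partComap]
      simp only [Kind_swap_swap, Pauli.part_op_self]
      exact AddSubgroup.subset_closure ⟨d, rfl⟩
  · refine Pauli.op_mem_of_mem_closure ?_
    rintro _ ⟨d, rfl⟩
    refine Subgroup.subset_closure (.inr ⟨d, ?_⟩)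
    simp only [Kind_swap_swap]

theorem mul_liftError_mem_harmless_iff (err : Pauli (E ⊕ V)) (y : Kind → E ⊕ V → ZMod 2) :
    err * liftError y ∈ C.harmless ↔
      ∀ κ, Pauli.op κ (err.part κ + y κ) ∈ (C.decodingGraph κ).surfaceStabilizer κ.swap := by
  simp only [mem_harmless_iff, op_mem_surfaceStabilizer_iff, Pauli.part_mul, part_liftError]

end gauge

end SubsystemSurfaceCode

/-! ## Reasoning about programs -/

/-- The program, run on the memory `m`, takes at most `B` steps and ends in a memory that
satisfies `Q`. -/
def Program.Meets (dec : Decoder) (p : Program) (m : Mem) (B : ℕ) (Q : Mem → Prop) : Prop :=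
  Q (p.run dec m).1 ∧ (p.run dec m).2 ≤ B

namespace Program.Meets

variable {dec : Decoder} {p p' : Program} {m : Mem} {B B' : ℕ} {Q Q' : Mem → Prop}

theorem mono (h : Meets dec p m B Q) (hB : B ≤ B') (hQ : ∀ u, Q u → Q' u) :
    Meets dec p m B' Q' :=
  ⟨hQ _ h.1, h.2.trans hB⟩

theorem set {r : ℕ} {e : Expr} (h : Q { m with reg := Function.update m.reg r (e.eval m) }) :
    Meets dec (.set r e) m (e.cost + 1) Q :=
  ⟨h, le_rfl⟩

theorem put {a : ℕ} {i e : Expr}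
    (h : Q { m with
      arr := Function.update m.arr a (Function.update (m.arr a) (i.eval m) (e.eval m)) }) :
    Meets dec (.put a i e) m (i.cost + e.cost + 1) Q :=
  ⟨h, le_rfl⟩

theorem seq (h : Meets dec p m B Q) (h' : ∀ u, Q u → Meets dec p' u B' Q') :
    Meets dec (.seq p p') m (B + B') Q' :=
  ⟨(h' _ h.1).1, Nat.add_le_add h.2 (h' _ h.1).2⟩

theorem ite {e : Expr} (h : e.eval m ≠ 0 → Meets dec p m B Q)
    (h' : e.eval m = 0 → Meets dec p' m B Q) :
    Meets dec (.ite e p p') m (e.cost + 1 + B) Q := by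
  by_cases he : e.eval m = 0
  · have := h' he
    simpa [Meets, Program.run, he] using this
  · have := h he
    simpa [Meets, Program.run, he] using this

/-- The invariant is stated for the memory before the counter register is written; the extra step
per round pays for the loop itself. -/
theorem loop {r : ℕ} {e : Expr} (Inv : ℕ → Mem → Prop) (h0 : Inv 0 m)
    (hs : ∀ i u, i < e.eval m → Inv i u →
      Meets dec p { u with reg := Function.update u.reg r i } B (Inv (i + 1))) :
    Meets dec (.loop r e p) m (e.cost + 1 + e.eval m * (B + 1)) (Inv (e.eval m)) := by
  -- A copy of the recursion step in `Program.run`, so that the conclusion holds by unfolding.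
  let G : ℕ → Mem × ℕ → Mem × ℕ := fun i u =>
    let w := p.run dec { u.1 with reg := Function.update u.1.reg r i }
    (w.1, u.2 + w.2 + 1)
  have key : ∀ k ≤ e.eval m, Inv k (Nat.rec (m, e.cost + 1) G k : Mem × ℕ).1 ∧
      (Nat.rec (m, e.cost + 1) G k : Mem × ℕ).2 ≤ e.cost + 1 + k * (B + 1) := by
    intro k
    induction k with
    | zero => exact fun _ => ⟨h0, by simp⟩
    | succ k ih =>
      intro hk
      obtain ⟨h1, h2⟩ := ih (by omega)
      obtain ⟨h3, h4⟩ := hs k _ (by omega) h1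
      refine ⟨h3, ?_⟩
      rw [Nat.add_mul, one_mul, ← add_assoc]
      exact (Nat.add_le_add_right (Nat.add_le_add h2 h4) 1).trans_eq (by ring)
  exact key _ le_rfl

end Program.Meets

/-! ## Numberings -/

namespace IsNumbering

variable {A : Type} {f : A → ℕ} {n : ℕ}

theorem lt (h : IsNumbering f n) (a : A) : f a < n := by
  have : f a ∈ Set.range f := ⟨a, rfl⟩
  rwa [h.2] at this

theorem exists_eq (h : IsNumbering f n) {i : ℕ} (hi : i < n) : ∃ a, f a = i := by
  have : i ∈ Set.range f := by rw [h.2]; exact hi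
  exact this

theorem card_eq [Fintype A] (h : IsNumbering f n) : Fintype.card A = n := by
  have := Set.ncard_range_of_injective h.1
  rw [h.2, Nat.card_eq_fintype_card] at this
  rw [← this, ← Finset.coe_Iio, Set.ncard_coe_finset, Nat.card_Iio]

theorem qubitNumber {V E : Type} [Fintype E] {numV : V → ℕ} {numE : E → ℕ} {nV nE : ℕ}
    (hV : IsNumbering numV nV) (hE : IsNumbering numE nE) :
    IsNumbering (qubitNumber numV numE) (nE + nV) := by
  have hc := hE.card_eq
  constructor
  · rintro (e | v) (e' | v') h <;> simp only [_root_.qubitNumber, Sum.elim_inl, Sum.elim_inr] at h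
    · rw [hE.1 h]
    · have := hE.lt e; omega
    · have := hE.lt e'; omega
    · rw [hV.1 (Nat.add_left_cancel h)]
  · ext i
    constructor
    · rintro ⟨e | v, rfl⟩
      · have := hE.lt e
        simp only [_root_.qubitNumber, Sum.elim_inl, Set.mem_Iio]; omega
      · have := hV.lt v
        simp only [_root_.qubitNumber, Sum.elim_inr, Set.mem_Iio]; omega
    · intro hi
      rw [Set.mem_Iio] at hi
      by_cases h : i < nE
      · obtain ⟨e, rfl⟩ := hE.exists_eq h
        exact ⟨.inl e, rfl⟩
      · obtain ⟨v, hv⟩ := hV.exists_eq (i := i - nE) (by omega)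
        refine ⟨.inr v, ?_⟩
        simp only [_root_.qubitNumber, Sum.elim_inr]; omega

end IsNumbering

theorem List.getD_map_range {A : Type} (f : ℕ → A) (a : A) {n i : ℕ} (h : i < n) :
    ((List.range n).map f).getD i a = f i := by
  simp [h]

/-! ## The decoding program -/

namespace Decoding

/-- The dart at hand. -/
def dart : Expr := .reg 11

/-- The next dart at a vertex. -/
def rot (e : Expr) : Expr := .get 0 e

/-- The reversed dart. -/
def rev (e : Expr) : Expr := .get 1 e

/-- The face on the left of a dart. -/
def leftFace (e : Expr) : Expr := .get 4 e

/-- Not zero if and only if the triangle at a corner has type `κ`. -/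
def hasCol : Kind → Expr → Expr
  | .X, e => .sub (.const 1) (.get 5 e)
  | .Z, e => .get 5 e

/-- Record ends `v`, `w` and sides `f`, `g` for the qubit `i`. -/
def record (i v w f g : Expr) : Program :=
  .seq (.put 10 i v) (.seq (.put 11 i w) (.seq (.put 12 i f) (.put 13 i g)))

/-- Record the qubit on the edge of the dart at hand and, if the triangle at the corner of this
dart has the type opposite to `κ`, the qubit at its vertex. -/
def recordDart (κ : Kind) : Program :=
  .ite (hasCol κ dart)
    (record (.get 3 dart) (leftFace dart) (leftFace (rev dart)) (rev dart) dart)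
    (.seq
      (record (.get 3 dart) (leftFace dart) (leftFace (rev dart)) (rot (rot (rot (rev dart))))
        (rot (rot (rot dart))))
      (record (.add (.reg 2) (.get 2 dart)) (leftFace dart) (leftFace (rot (rot dart)))
        (rot (rot (rot dart))) (rot dart)))

/-- The array that holds the syndrome of the errors of type `κ`. -/
def synArray : Kind → ℕ
  | .X => 7
  | .Z => 6

/-- Build the decoding graph for errors of type `κ` and call the decoder on it. -/
def decodePart (κ : Kind) : Program :=
  .seq (.loop 11 (.reg 0) (recordDart κ)) (.call 3 10 10 11 12 13 (synArray κ) (outArray κ))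

/-- The decoding program. -/
def program : Program :=
  .seq (.set 10 (.add (.reg 2) (.reg 1))) (.seq (decodePart .X) (decodePart .Z))

/-- The two memories agree except in the registers and arrays that recording uses. -/
def Agree (m u : Mem) : Prop :=
  (∀ a < 10, u.arr a = m.arr a) ∧ ∀ r < 11, u.reg r = m.reg r

theorem Agree.trans {m u w : Mem} (h : Agree m u) (h' : Agree u w) : Agree m w :=
  ⟨fun a ha => (h'.1 a ha).trans (h.1 a ha), fun r hr => (h'.2 r hr).trans (h.2 r hr)⟩

variable {D V E F : Type} (C : SubsystemSurfaceCode D V E F)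
  (numD : D → ℕ) (numV : V → ℕ) (numE : E → ℕ) (numF : F → ℕ)

/-- The memory records the qubit `q` with the ends and sides of some dart of this qubit. -/
def Recorded [Fintype E] (κ : Kind) (u : Mem) (q : E ⊕ V) : Prop :=
  ∃ x, (C.decodingGraph κ).edge x = q ∧
    u.arr 10 (qubitNumber numV numE q) = numF ((C.decodingGraph κ).vert x) ∧
    u.arr 11 (qubitNumber numV numE q) =
      numF ((C.decodingGraph κ).vert ((C.decodingGraph κ).α x)) ∧
    u.arr 12 (qubitNumber numV numE q) = numD ((C.decodingGraph κ).face x).1 ∧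
    u.arr 13 (qubitNumber numV numE q) =
      numD ((C.decodingGraph κ).face ((C.decodingGraph κ).α x)).1

variable {C numD numV numE numF}

/-- The input lies in arrays below 8 and registers below 4, so neither scratch space nor the output
arrays 8 and 9 can spoil it. -/
theorem holds_of_agree {s : Kind → F → ZMod 2} {m u : Mem} (ha : ∀ a < 8, u.arr a = m.arr a)
    (hr : ∀ r < 4, u.reg r = m.reg r) (h : m.Holds C s numD numV numE numF) :
    u.Holds C s numD numV numE numF where
  darts := by rw [hr 0 (by omega)]; exact h.darts
  vertices := by rw [hr 1 (by omega)]; exact h.vertices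
  edges := by rw [hr 2 (by omega)]; exact h.edges
  faces := by rw [hr 3 (by omega)]; exact h.faces
  rotation := by rw [ha 0 (by omega)]; exact h.rotation
  reversal := by rw [ha 1 (by omega)]; exact h.reversal
  vert := by rw [ha 2 (by omega)]; exact h.vert
  edge := by rw [ha 3 (by omega)]; exact h.edge
  face := by rw [ha 4 (by omega)]; exact h.face
  colour := by rw [ha 5 (by omega)]; exact h.colour
  synX := by rw [ha 6 (by omega)]; exact h.synX
  synZ := by rw [ha 7 (by omega)]; exact h.synZ

theorem eval_hasCol {s : Kind → F → ZMod 2} {m : Mem} (h : m.Holds C s numD numV numE numF)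
    (κ : Kind) (d : D) {e : Expr} (he : e.eval m = numD d) :
    (hasCol κ e).eval m ≠ 0 ↔ C.col d = κ := by
  have := h.colour d
  cases κ <;> cases hc : C.col d <;> simp_all [hasCol, Expr.eval]

variable [Fintype E]

/-- The hypothesis ranges over all memories that agree below array 10, because the later expressions
are evaluated after the earlier writes. -/
theorem record_meets (dec : Decoder) (hq : Function.Injective (qubitNumber numV numE)) {κ : Kind}
    (x : C.DecodingDart κ) {i v w f g : Expr} {u : Mem}
    (h : ∀ u' : Mem, (∀ a < 10, u'.arr a = u.arr a) → u'.reg = u.reg →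
      i.eval u' = qubitNumber numV numE ((C.decodingGraph κ).edge x) ∧
      v.eval u' = numF ((C.decodingGraph κ).vert x) ∧
      w.eval u' = numF ((C.decodingGraph κ).vert ((C.decodingGraph κ).α x)) ∧
      f.eval u' = numD ((C.decodingGraph κ).face x).1 ∧
      g.eval u' = numD ((C.decodingGraph κ).face ((C.decodingGraph κ).α x)).1) :
    (record i v w f g).Meets dec u (4 * i.cost + v.cost + w.cost + f.cost + g.cost + 4) fun u' =>
      Agree u u' ∧ u'.reg = u.reg ∧
      Recorded C numD numV numE numF κ u' ((C.decodingGraph κ).edge x) ∧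
      ∀ q, Recorded C numD numV numE numF κ u q → Recorded C numD numV numE numF κ u' q := by
  set u₁ : Mem := { u with
    arr := Function.update u.arr 10 (Function.update (u.arr 10) (i.eval u) (v.eval u)) } with hu₁
  set u₂ : Mem := { u₁ with
    arr := Function.update u₁.arr 11 (Function.update (u₁.arr 11) (i.eval u₁) (w.eval u₁)) } with hu₂
  set u₃ : Mem := { u₂ with
    arr := Function.update u₂.arr 12 (Function.update (u₂.arr 12) (i.eval u₂) (f.eval u₂)) } with hu₃
  set u₄ : Mem := { u₃ with
    arr := Function.update u₃.arr 13 (Function.update (u₃.arr 13) (i.eval u₃) (g.eval u₃)) } with hu₄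
  have hrun : (record i v w f g).Meets dec u
      (4 * i.cost + v.cost + w.cost + f.cost + g.cost + 4) fun u' => u' = u₄ := by
    refine ⟨rfl, ?_⟩
    simp only [record, Program.run]
    omega
  refine hrun.mono le_rfl ?_
  rintro _ rfl
  have h₁ : ∀ a < 10, u₁.arr a = u.arr a := fun a ha => by
    rw [hu₁]; exact Function.update_of_ne (by omega) _ _
  have h₂ : ∀ a < 10, u₂.arr a = u.arr a := fun a ha => by
    rw [← h₁ a ha, hu₂]; exact Function.update_of_ne (by omega) _ _
  have h₃ : ∀ a < 10, u₃.arr a = u.arr a := fun a ha => by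
    rw [← h₂ a ha, hu₃]; exact Function.update_of_ne (by omega) _ _
  have h₄ : ∀ a < 10, u₄.arr a = u.arr a := fun a ha => by
    rw [← h₃ a ha, hu₄]; exact Function.update_of_ne (by omega) _ _
  obtain ⟨i0, v0, -⟩ := h u (fun _ _ => rfl) rfl
  obtain ⟨i1, -, w1, -⟩ := h u₁ h₁ rfl
  obtain ⟨i2, -, -, f2, -⟩ := h u₂ h₂ rfl
  obtain ⟨i3, -, -, -, g3⟩ := h u₃ h₃ rfl
  have e10 : u₄.arr 10 = Function.update (u.arr 10) (i.eval u) (v.eval u) := by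
    simp [hu₄, hu₃, hu₂, hu₁]
  have e11 : u₄.arr 11 = Function.update (u.arr 11) (i.eval u₁) (w.eval u₁) := by
    simp [hu₄, hu₃, hu₂, hu₁]
  have e12 : u₄.arr 12 = Function.update (u.arr 12) (i.eval u₂) (f.eval u₂) := by
    simp [hu₄, hu₃, hu₂, hu₁]
  have e13 : u₄.arr 13 = Function.update (u.arr 13) (i.eval u₃) (g.eval u₃) := by
    simp [hu₄, hu₃, hu₂, hu₁]
  rw [i0, v0] at e10
  rw [i1, w1] at e11
  rw [i2, f2] at e12
  rw [i3, g3] at e13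
  have hx : Recorded C numD numV numE numF κ u₄ ((C.decodingGraph κ).edge x) :=
    ⟨x, rfl, by rw [e10, Function.update_self], by rw [e11, Function.update_self],
      by rw [e12, Function.update_self], by rw [e13, Function.update_self]⟩
  refine ⟨⟨h₄, fun _ _ => rfl⟩, rfl, hx, ?_⟩
  rintro q ⟨y, rfl, hy⟩
  -- Overwriting the same qubit is harmless, since `Recorded` accepts any dart of the qubit; other
  -- qubits use other cells.
  by_cases hxy : (C.decodingGraph κ).edge y = (C.decodingGraph κ).edge x
  · rwa [hxy]
  · refine ⟨y, rfl, ?_⟩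
    have := hq.ne hxy
    rwa [e10, e11, e12, e13, Function.update_of_ne this, Function.update_of_ne this,
      Function.update_of_ne this, Function.update_of_ne this]

/-- The sides depend on the colour as in `decodingFace`. Three rotations stand for $\sigma^{-1}$, as
the graph is 4-valent and no inverse table is stored. -/
theorem recordDart_meets (dec : Decoder) {s : Kind → F → ZMod 2} {m : Mem}
    (h : m.Holds C s numD numV numE numF) (κ : Kind) (d : D) (hd : m.reg 11 = numD d) :
    (recordDart κ).Meets dec m 100 fun u => Agree m u ∧
      (∀ x : C.DecodingDart κ, Sum.elim id Subtype.val x = d →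
        Recorded C numD numV numE numF κ u ((C.decodingGraph κ).edge x)) ∧
      ∀ q, Recorded C numD numV numE numF κ m q → Recorded C numD numV numE numF κ u q := by
  have hq := (h.vertices.qubitNumber h.edges).1
  have hcost : (hasCol κ dart).cost ≤ 4 := by cases κ <;> simp [hasCol, dart, Expr.cost]
  have hcE := h.edges.card_eq
  have hH : ∀ u : Mem, (∀ a < 10, u.arr a = m.arr a) → u.reg = m.reg →
      u.Holds C s numD numV numE numF ∧ u.reg 11 = numD d := fun u ha hr =>
    ⟨holds_of_agree (fun a h => ha a (by omega)) (fun r _ => by rw [hr]) h, by rw [hr, hd]⟩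
  -- A generous bound: 90 covers the longer branch, with two records.
  refine Program.Meets.mono (B := (hasCol κ dart).cost + 1 + 90)
    (Program.Meets.ite (Q := fun u => Agree m u ∧
      (∀ x : C.DecodingDart κ, Sum.elim id Subtype.val x = d →
        Recorded C numD numV numE numF κ u ((C.decodingGraph κ).edge x)) ∧
      ∀ q, Recorded C numD numV numE numF κ m q → Recorded C numD numV numE numF κ u q) ?_ ?_)
    (by omega) fun _ h => h
  · intro hc
    replace hc := (eval_hasCol h κ d (e := dart) hd).1 hc
    refine (record_meets dec (C := C) (numD := numD) (numF := numF) hq (κ := κ) (.inl d)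
      ?_).mono (by simp [dart, leftFace, rev, Expr.cost]) ?_
    · intro u ha hr
      obtain ⟨hu, hdu⟩ := hH u ha hr
      have hα : C.col (C.α d) = κ := by rw [C.col_α, hc]
      simp [dart, leftFace, rev, Expr.eval, hdu, hu.edge, hu.face, hu.reversal,
        SubsystemSurfaceCode.decodingGraph, qubitNumber, SubsystemSurfaceCode.decodingReversal,
        SubsystemSurfaceCode.decodingFace, hc, hα, C.α_α]
    · rintro u ⟨hu, -, hx, hmono⟩
      refine ⟨hu, ?_, hmono⟩
      rintro (x | x) rfl
      · exact hx
      · exact absurd (x.2.symm.trans hc) (SubsystemSurfaceCode.swap_ne κ)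
  · intro hc
    replace hc : C.col d ≠ κ := fun h' => (eval_hasCol h κ d (e := dart) hd).2 h' hc
    have hc' := (Kind.eq_swap_iff _ _).2 hc
    have hα : C.col (C.α d) ≠ κ := by rwa [C.col_α]
    refine (Program.Meets.seq (record_meets dec (C := C) (numD := numD)
      (numF := numF) hq (κ := κ) (.inl d) ?_) (Q' := fun u => Agree m u ∧
      (∀ x : C.DecodingDart κ, Sum.elim id Subtype.val x = d →
        Recorded C numD numV numE numF κ u ((C.decodingGraph κ).edge x)) ∧
      ∀ q, Recorded C numD numV numE numF κ m q → Recorded C numD numV numE numF κ u q)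
      fun u₁ hu₁ => ((record_meets dec (C := C) (numD := numD)
      (numF := numF) hq (κ := κ) (.inr ⟨d, hc'⟩) ?_).mono le_rfl ?_)).mono ?_ fun _ h => h
    · intro u ha hr
      obtain ⟨hu, hdu⟩ := hH u ha hr
      simp [dart, leftFace, rev, rot, Expr.eval, hdu, hu.edge, hu.face, hu.reversal, hu.rotation,
        SubsystemSurfaceCode.decodingGraph, qubitNumber, SubsystemSurfaceCode.decodingReversal,
        SubsystemSurfaceCode.decodingFace, hc, hα, C.α_α, EmbeddedGraph.φ]
      exact ⟨congrArg numD (C.σ_inv _).symm, congrArg numD (C.σ_inv _).symm⟩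
    · obtain ⟨ha₁, hr₁, -⟩ := hu₁
      intro u ha hr
      obtain ⟨hu, hdu⟩ := hH u (fun a h => (ha a h).trans (ha₁.1 a h)) (hr.trans hr₁)
      have h2 : u.reg 2 = Fintype.card E := by rw [hr, hr₁, hcE]
      simp [dart, leftFace, rot, Expr.eval, hdu, h2, hu.vert, hu.face, hu.rotation,
        SubsystemSurfaceCode.decodingGraph, qubitNumber, SubsystemSurfaceCode.decodingReversal,
        SubsystemSurfaceCode.decodingFace, C.σ_inv, (C.σ_pow_four _).1]
    · obtain ⟨ha₁, -, hx₁, hmono₁⟩ := hu₁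
      rintro u ⟨hu, -, hx, hmono⟩
      refine ⟨ha₁.trans hu, ?_, fun q hq => hmono q (hmono₁ q hq)⟩
      rintro (x | ⟨x, hx'⟩) rfl
      · exact hmono _ hx₁
      · exact hx
    · simp [dart, leftFace, rev, rot, Expr.cost]

/-- The names of the triangles of type `κ` in the instance that the decoding program presents to
the decoder: the numbers of their corners. -/
def triangleNumber (C : SubsystemSurfaceCode D V E F) (numD : D → ℕ) (κ : Kind) :
    {d : D // C.col d = κ} → ℕ := fun d => numD d.1

/-- After the loop every dart of the decoding graph has had its qubit recorded, and every qubit has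
a dart. Triangles keep the numbers of their corners, which are below $|D|=2|E|$, so no renumbering
is needed. -/
theorem decodePart_meets [Fintype D] [Fintype V] (dec : Decoder) {s : Kind → F → ZMod 2} {m : Mem}
    (h : m.Holds C s numD numV numE numF) (h10 : m.reg 10 = m.reg 2 + m.reg 1) (κ : Kind) :
    ∃ I : SurfaceInstance, I.Describes (C.decodingGraph κ) (s κ.swap) numF
        (qubitNumber numV numE) (triangleNumber C numD κ) ∧
      (decodePart κ).Meets dec m (m.reg 0 * 101 + m.reg 3 + m.reg 10 + 3 + (dec I).2) fun u =>
        (∀ a < 10, a ≠ outArray κ → u.arr a = m.arr a) ∧ (∀ r < 11, u.reg r = m.reg r) ∧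
        ∀ i, u.arr (outArray κ) i = (dec I).1.getD i 0 := by
  have hloop := Program.Meets.loop (dec := dec) (p := recordDart κ) (m := m) (r := 11) (e := .reg 0)
    (B := 100) (fun i u => Agree m u ∧ ∀ x : C.DecodingDart κ, numD (Sum.elim id Subtype.val x) < i →
      Recorded C numD numV numE numF κ u ((C.decodingGraph κ).edge x))
    ⟨⟨fun _ _ => rfl, fun _ _ => rfl⟩, fun _ h => absurd h (by omega)⟩ (by
      rintro i u hi ⟨hu, hrec⟩
      obtain ⟨d, rfl⟩ := h.darts.exists_eq hi
      set u₁ : Mem := { u with reg := Function.update u.reg 11 (numD d) } with hu₁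
      have hA : Agree m u₁ :=
        ⟨hu.1, fun r hr => (Function.update_of_ne (by omega) _ _).trans (hu.2 r hr)⟩
      refine (recordDart_meets dec (holds_of_agree (fun a h => hA.1 a (by omega))
        (fun r h => hA.2 r (by omega)) h) κ d (by simp [hu₁])).mono le_rfl ?_
      rintro w ⟨hw, hnew, hold⟩
      refine ⟨hA.trans hw, fun x hx => ?_⟩
      rcases Nat.lt_succ_iff_lt_or_eq.1 hx with hx | hx
      · exact hold _ (hrec x hx)
      · exact hnew x (h.darts.1 hx))
  obtain ⟨⟨hA, hrec⟩, hcost⟩ := hloop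
  simp only [Expr.eval, Expr.cost] at hA hrec hcost
  set u := (Program.run dec (.loop 11 (.reg 0) (recordDart κ)) m).1 with hu
  have hqn := h.vertices.qubitNumber h.edges
  have h10' : u.reg 10 = m.reg 2 + m.reg 1 := by rw [hA.2 10 (by omega), h10]
  refine ⟨u.instanceAt 3 10 10 11 12 13 (synArray κ), ?_, ?_⟩
  · constructor
    · simpa [Mem.instanceAt, hA.2 3] using h.faces
    · simpa [Mem.instanceAt, h10'] using hqn
    · refine ⟨fun a b hab => Subtype.ext (h.darts.1 hab), fun t => ?_⟩
      simp only [Mem.instanceAt, List.length_map, List.length_range, h10']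
      have h1 := h.darts.lt t.1
      have h2 := h.darts.card_eq
      have h3 := C.card_dart_eq_two_mul_card_edge
      have h4 := h.edges.card_eq
      simp only [triangleNumber]
      omega
    · simp [Mem.instanceAt]
    · intro f
      rw [Mem.instanceAt, List.getD_map_range _ _ (by rw [hA.2 3 (by omega)]; exact h.faces.lt f)]
      -- Bit flips are read from the `Z`-type checks and phase flips from the `X`-type checks.
      cases κ
      · exact (congrFun (hA.1 7 (by omega)) _).trans (h.synZ f)
      · exact (congrFun (hA.1 6 (by omega)) _).trans (h.synX f)
    · intro q
      obtain ⟨x, rfl⟩ := (C.decodingGraph κ).edge_surj q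
      obtain ⟨y, hy, h1, h2, h3, h4⟩ := hrec x (h.darts.lt _)
      have hlt := hqn.lt ((C.decodingGraph κ).edge x)
      rw [← h10'] at hlt
      refine ⟨y, hy, ?_, ?_⟩
      · rw [Mem.instanceAt, List.getD_map_range _ _ hlt, h1, h2]
      · rw [Mem.instanceAt, List.getD_map_range _ _ hlt, h3, h4]
        rfl
  · refine ⟨⟨fun a ha hne => ?_, hA.2, fun i => ?_⟩, ?_⟩
    · exact (Function.update_of_ne hne _ _).trans (hA.1 a ha)
    · exact congrFun (Function.update_self (outArray κ) _ u.arr) i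
    · have h3 := hA.2 3 (by omega)
      have h10'' := hA.2 10 (by omega)
      have hrun : ((decodePart κ).run dec m).2 = (Program.run dec (.loop 11 (.reg 0) (recordDart κ)) m).2 +
          ((dec (u.instanceAt 3 10 10 11 12 13 (synArray κ))).2 + u.reg 3 + u.reg 10 + 1) := rfl
      rw [hrun, h3, h10'']
      omega

end Decoding

/-! ## A surface-code decoder -/

namespace SurfaceDecoder

/-! ### Component labels and parities on components -/

section labels

variable (a b : ℕ → ℕ)

/-- The labels of the vertices after the ends of the edges `0, …, j - 1` have been merged; the
`j`-th edge joins `a j` and `b j`. -/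
def labels : ℕ → ℕ → ℕ
  | 0, v => v
  | j + 1, v => if labels j v = labels j (a j) then labels j (b j) else labels j v

/-- Merging never separates vertices that already share a label. -/
theorem labels_eq_of_le {i j u v : ℕ} (hij : i ≤ j) (h : labels a b i u = labels a b i v) :
    labels a b j u = labels a b j v := by
  induction j, hij using Nat.le_induction with
  | base => exact h
  | succ j _ ih => simp only [labels, ih]

theorem labels_ends {i j : ℕ} (h : i < j) : labels a b j (a i) = labels a b j (b i) := by
  refine labels_eq_of_le a b (Nat.succ_le_of_lt h) ?_
  simp [labels]

/-- The number, modulo 2, of ends of the edge `j` at the vertex `v`. -/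
def incidence (j v : ℕ) : ZMod 2 := (if a j = v then 1 else 0) + if b j = v then 1 else 0

variable {a b}

theorem sum_incidence {A : Type} [DecidableEq A] {n j : ℕ} (ha : a j < n) (hb : b j < n)
    (L : ℕ → A) (l : A) :
    (∑ v ∈ Finset.range n, if L v = l then incidence a b j v else 0) =
      (if L (a j) = l then 1 else 0) + if L (b j) = l then 1 else 0 := by
  have h : ∀ w < n, (∑ v ∈ Finset.range n, if L v = l then (if w = v then (1 : ZMod 2) else 0) else 0) =
      if L w = l then 1 else 0 := by
    intro w hw
    rw [Finset.sum_eq_single w]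
    · simp
    · intro v _ hv; simp [hv.symm]
    · intro h'; exact absurd (Finset.mem_range.2 hw) h'
  rw [← h _ ha, ← h _ hb, ← Finset.sum_add_distrib]
  refine Finset.sum_congr rfl fun v _ => ?_
  by_cases hv : L v = l <;> simp [hv, incidence]

/-- The sum of `R` over the class with label `l`. -/
def classSum (n : ℕ) (L : ℕ → ℕ) (R : ℕ → ZMod 2) (l : ℕ) : ZMod 2 :=
  ∑ v ∈ Finset.range n, if L v = l then R v else 0

theorem classSum_congr {n : ℕ} {L L' : ℕ → ℕ} {R R' : ℕ → ZMod 2} {l : ℕ}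
    (hL : ∀ v < n, L v = L' v) (hR : ∀ v < n, R v = R' v) :
    classSum n L R l = classSum n L' R' l := by
  refine Finset.sum_congr rfl fun v hv => ?_
  rw [hL v (Finset.mem_range.1 hv), hR v (Finset.mem_range.1 hv)]

/-- Both ends of every edge lie in one class, so each edge contributes an even number; this starts
the invariant of the decoder. -/
theorem classSum_boundary {n m : ℕ} (ha : ∀ j < m, a j < n) (hb : ∀ j < m, b j < n)
    (x : ℕ → ZMod 2) (l : ℕ) :
    classSum n (labels a b m) (fun v => ∑ j ∈ Finset.range m, incidence a b j v * x j) l = 0 := by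
  have h2 : ∀ t : ZMod 2, t + t = 0 := by decide
  have h : classSum n (labels a b m) (fun v => ∑ j ∈ Finset.range m, incidence a b j v * x j) l =
      ∑ j ∈ Finset.range m, (∑ v ∈ Finset.range n,
        if labels a b m v = l then incidence a b j v else 0) * x j := by
    simp only [classSum, Finset.sum_mul, ite_mul, zero_mul]
    rw [Finset.sum_comm]
    refine Finset.sum_congr rfl fun v _ => ?_
    split_ifs <;> simp
  rw [h]
  refine Finset.sum_eq_zero fun j hj => ?_
  rw [Finset.mem_range] at hj
  rw [sum_incidence (ha j hj) (hb j hj), labels_ends a b hj, h2, zero_mul]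

/-- If every class sum vanishes after merging along the edge `e`, then the class sums before
merging can be made to vanish by changing `R` at the ends of `e`. -/
theorem classSum_update {n e : ℕ} (ha : a e < n) (hb : b e < n) {R R' : ℕ → ZMod 2}
    (h : ∀ l, classSum n (labels a b (e + 1)) R l = 0)
    (hR : ∀ v < n, R' v = R v +
      incidence a b e v * classSum n (labels a b e) R (labels a b e (a e))) (l : ℕ) :
    classSum n (labels a b e) R' l = 0 := by
  have h2 : ∀ t : ZMod 2, t + t = 0 := by decide
  set L := labels a b e with hL
  set p := L (a e) with hp
  set q := L (b e) with hq
  have hR' : classSum n L R' l = classSum n L R l +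
      ((if p = l then 1 else 0) + if q = l then 1 else 0) * classSum n L R p := by
    rw [hp, hq, ← sum_incidence ha hb, Finset.sum_mul, classSum, classSum,
      ← Finset.sum_add_distrib]
    refine Finset.sum_congr rfl fun v hv => ?_
    rw [hR v (Finset.mem_range.1 hv)]
    by_cases hl : L v = l <;> simp only [hl, if_true, if_false, add_zero, zero_mul]
    rw [hp]
  have hsucc : ∀ v, labels a b (e + 1) v = if L v = p then q else L v := fun v => rfl
  rw [hR']
  -- If the ends already share a class, merging changes nothing and the value added is itself zero.
  by_cases hpq : p = q
  · have : ∀ v, labels a b (e + 1) v = L v := fun v => by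
      rw [hsucc]; split_ifs with h' <;> simp [h', hpq]
    have h' : ∀ l, classSum n L R l = 0 := fun l => by
      rw [← h l]; exact classSum_congr (fun v _ => (this v).symm) fun _ _ => rfl
    rw [h', h', mul_zero, add_zero]
  -- Otherwise the merged class is the union of the two, so their parities agree and the same bit
  -- corrects both.
  · have hsum : classSum n L R p + classSum n L R q = 0 := by
      rw [← h q, classSum, classSum, classSum, ← Finset.sum_add_distrib]
      refine Finset.sum_congr rfl fun v _ => ?_
      rw [hsucc]
      by_cases h1 : L v = p
      · simp [h1, hpq]
      · simp [h1]
    by_cases hlp : p = l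
    · subst hlp
      rw [if_pos rfl, if_neg (Ne.symm hpq), add_zero, one_mul, h2]
    · by_cases hlq : q = l
      · subst hlq
        rw [if_neg hpq, if_pos rfl, zero_add, one_mul, add_comm, hsum]
      · rw [if_neg hlp, if_neg hlq, add_zero, zero_mul, add_zero, ← h l]
        refine Finset.sum_congr rfl fun v _ => ?_
        rw [hsucc]
        by_cases h1 : L v = p
        · simp [h1, hlp, hlq]
        · simp [h1]

end labels

/-! ### The elimination decoder and its step count -/

section program

/-- The distance of two numbers, zero if and only if they are equal; on bits it is the sum
modulo 2. -/
def dist (s t : Expr) : Expr := .add (.sub s t) (.sub t s)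

theorem eval_dist_eq_zero_iff (m : Mem) (s t : Expr) :
    (dist s t).eval m = 0 ↔ s.eval m = t.eval m := by
  simp only [dist, Expr.eval]; omega

theorem eval_dist_bits {m : Mem} {s t : Expr} (hs : s.eval m ≤ 1) (ht : t.eval m ≤ 1) :
    (dist s t).eval m ≤ 1 ∧
      (((dist s t).eval m : ℕ) : ZMod 2) = (s.eval m : ZMod 2) + (t.eval m : ZMod 2) := by
  have h2 : (1 : ZMod 2) + 1 = 0 := by decide
  simp only [dist, Expr.eval]
  generalize s.eval m = i at *
  generalize t.eval m = j at *
  interval_cases i <;> interval_cases j <;> simp [h2]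

/-- Give every vertex its own label. -/
def initLabels : Program := .loop 5 (.reg 0) (.put 6 (.reg 5) (.reg 5))

/-- Replace the label in register `6` by the label in register `7`. -/
def replaceLabel : Program :=
  .loop 5 (.reg 0) (.ite (dist (.get 6 (.reg 5)) (.reg 6)) (.set 9 (.const 0))
    (.put 6 (.reg 5) (.reg 7)))

/-- Merge the ends of the edges whose numbers are smaller than register `3`. -/
def mergeEdges : Program :=
  .loop 4 (.reg 3) (.seq (.set 6 (.get 6 (.get 0 (.reg 4))))
    (.seq (.set 7 (.get 6 (.get 1 (.reg 4)))) replaceLabel))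

/-- The sum, modulo 2, of the residual syndrome over the class with the label in register `6`. -/
def sumClass : Program :=
  .seq (.set 8 (.const 0)) (.loop 5 (.reg 0) (.ite (dist (.get 6 (.reg 5)) (.reg 6))
    (.set 9 (.const 0)) (.set 8 (dist (.reg 8) (.get 4 (.reg 5))))))

/-- Add the value of register `8` to the estimate at the edge in register `3`, and to the
residual syndrome at its ends. -/
def updateEdge : Program :=
  .seq (.put 5 (.reg 3) (.reg 8))
    (.seq (.put 4 (.get 0 (.reg 3)) (dist (.get 4 (.get 0 (.reg 3))) (.reg 8)))
      (.put 4 (.get 1 (.reg 3)) (dist (.get 4 (.get 1 (.reg 3))) (.reg 8))))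

/-- Determine the estimate at one edge. -/
def decodeEdge : Program :=
  .seq (.set 3 (.sub (.sub (.reg 1) (.const 1)) (.reg 2)))
    (.seq initLabels (.seq mergeEdges (.seq (.set 6 (.get 6 (.get 0 (.reg 3))))
      (.seq sumClass updateEdge))))

/-- The decoder goes through the edges in decreasing order. For each edge it merges the ends of
all smaller edges and makes the residual syndrome even on the class of one end. -/
def program : Program := .loop 2 (.reg 1) decodeEdge

/-- Two memories agree except in the labels and auxiliary registers. -/
def Agree (m u : Mem) : Prop := (∀ a, a ≠ 6 → u.arr a = m.arr a) ∧ ∀ r < 4, u.reg r = m.reg r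

theorem Agree.refl (m : Mem) : Agree m m := ⟨fun _ _ => rfl, fun _ _ => rfl⟩

theorem Agree.trans {m u w : Mem} (h : Agree m u) (h' : Agree u w) : Agree m w :=
  ⟨fun a ha => (h'.1 a ha).trans (h.1 a ha), fun r hr => (h'.2 r hr).trans (h.2 r hr)⟩

theorem Agree.setReg {m u : Mem} (h : Agree m u) {r : ℕ} (hr : 4 ≤ r) (k : ℕ) :
    Agree m { u with reg := Function.update u.reg r k } :=
  ⟨h.1, fun r' hr' => (Function.update_of_ne (by omega) _ _).trans (h.2 r' hr')⟩

theorem Agree.putLabel {m u : Mem} (h : Agree m u) (f : ℕ → ℕ) :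
    Agree m { u with arr := Function.update u.arr 6 f } :=
  ⟨fun a ha => (Function.update_of_ne ha _ _).trans (h.1 a ha), h.2⟩

variable (dec : Decoder) {m : Mem}

theorem initLabels_meets : initLabels.Meets dec m (2 + m.reg 0 * 4) fun u =>
    Agree m u ∧ ∀ v < m.reg 0, u.arr 6 v = v := by
  refine Program.Meets.loop (e := .reg 0) (B := 3) (fun i u => Agree m u ∧ ∀ v < i, u.arr 6 v = v)
    ⟨Agree.refl m, fun _ h => absurd h (by omega)⟩ ?_
  rintro i u hi ⟨hu, hl⟩
  refine Program.Meets.put ⟨(hu.setReg (by omega) i).putLabel _, fun v hv => ?_⟩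
  simp only [Expr.eval, Function.update_self]
  rcases Nat.lt_succ_iff_lt_or_eq.1 hv with hv | rfl
  · rw [Function.update_of_ne hv.ne, hl v hv]
  · simp

/-- Old and new label sit in registers, so rewriting array 6 in place does not disturb the
comparison. The write to register 9 is a no-operation. -/
theorem replaceLabel_meets {L : ℕ → ℕ} (hL : ∀ v < m.reg 0, m.arr 6 v = L v) :
    replaceLabel.Meets dec m (2 + m.reg 0 * 15) fun u => Agree m u ∧
      ∀ v < m.reg 0, u.arr 6 v = if L v = m.reg 6 then m.reg 7 else L v := by
  refine Program.Meets.mono (Program.Meets.loop (e := .reg 0)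
    (B := (dist (.get 6 (.reg 5)) (.reg 6)).cost + 1 + 4)
    (fun i u => Agree m u ∧ u.reg 6 = m.reg 6 ∧ u.reg 7 = m.reg 7 ∧
      (∀ v < i, u.arr 6 v = if L v = m.reg 6 then m.reg 7 else L v) ∧
      ∀ v, i ≤ v → v < m.reg 0 → u.arr 6 v = L v)
    ⟨Agree.refl m, rfl, rfl, fun _ h => absurd h (by omega), fun v _ hv => hL v hv⟩ ?_)
    (by simp [Expr.cost, Expr.eval, dist])
    fun u hu => ⟨hu.1, hu.2.2.2.1⟩
  rintro i u hi ⟨hu, h6, h7, hlt, hge⟩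
  have hi' : u.arr 6 i = L i := hge i le_rfl hi
  refine Program.Meets.ite (B := 4) (fun hd => ?_) fun hd => ?_
  · rw [Ne, eval_dist_eq_zero_iff] at hd
    simp only [Expr.eval, Function.update_self, Function.update_of_ne (show (6 : ℕ) ≠ 5 by omega),
      hi', h6] at hd
    refine (Program.Meets.set ⟨(hu.setReg (by omega) i).setReg (by omega) _, ?_, ?_, ?_, ?_⟩).mono
      (by simp [Expr.cost]) fun _ h => h
    · simpa using h6
    · simpa using h7
    · intro v hv
      rcases Nat.lt_succ_iff_lt_or_eq.1 hv with hv | rfl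
      · exact hlt v hv
      · rw [if_neg hd]; exact hi'
    · exact fun v hv hv' => hge v (by omega) hv'
  · rw [eval_dist_eq_zero_iff] at hd
    simp only [Expr.eval, Function.update_self, Function.update_of_ne (show (6 : ℕ) ≠ 5 by omega),
      hi', h6] at hd
    refine (Program.Meets.put ⟨(hu.setReg (by omega) i).putLabel _, ?_, ?_, ?_, ?_⟩).mono
      (by simp [Expr.cost]) fun _ h => h
    · simpa using h6
    · simpa using h7
    · intro v hv
      simp only [Expr.eval, Function.update_self,
        Function.update_of_ne (show (7 : ℕ) ≠ 5 by omega), h7]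
      rcases Nat.lt_succ_iff_lt_or_eq.1 hv with hv | rfl
      · rw [Function.update_of_ne hv.ne]; exact hlt v hv
      · rw [Function.update_self, if_pos hd]
    · intro v hv hv'
      simp only [Expr.eval, Function.update_self]
      rw [Function.update_of_ne (by omega)]
      exact hge v (by omega) hv'

theorem mergeEdges_meets {n e : ℕ} {a b : ℕ → ℕ} (hn : m.reg 0 = n) (he : m.reg 3 = e)
    (h0 : m.arr 0 = a) (h1 : m.arr 1 = b) (ha : ∀ j < e, a j < n) (hb : ∀ j < e, b j < n)
    (hm : ∀ v < n, m.arr 6 v = v) :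
    mergeEdges.Meets dec m (2 + e * (n * 15 + 11)) fun u => Agree m u ∧
      ∀ v < n, u.arr 6 v = labels a b e v := by
  subst hn he
  refine Program.Meets.loop (e := .reg 3) (B := m.reg 0 * 15 + 10) (fun j u => Agree m u ∧
    ∀ v < m.reg 0, u.arr 6 v = labels a b j v) ⟨Agree.refl m, hm⟩ ?_
  rintro j u hj ⟨hu, hl⟩
  replace hj : j < m.reg 3 := hj
  have hua : u.arr 0 = a := (hu.1 0 (by omega)).trans h0
  have hub : u.arr 1 = b := (hu.1 1 (by omega)).trans h1
  have hun : u.reg 0 = m.reg 0 := hu.2 0 (by omega)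
  refine (Program.Meets.seq (B' := (2 + m.reg 0 * 15) + 4)
    (Program.Meets.set (Q := fun w => w = { u with
      reg := Function.update (Function.update u.reg 4 j) 6 (labels a b j (a j)) }) ?_) ?_).mono ?_ fun _ h => h
  · simp only [Expr.eval, Function.update_self, hua, hl _ (ha j hj)]
  · rintro _ rfl
    refine (Program.Meets.seq
      (Program.Meets.set (Q := fun w => w = { u with
        reg := Function.update (Function.update (Function.update u.reg 4 j) 6
          (labels a b j (a j))) 7 (labels a b j (b j)) }) ?_)
        (B' := 2 + m.reg 0 * 15) ?_).mono ?_ fun _ h => h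
    · simp [Expr.eval, hub, hl _ (hb j hj)]
    · rintro _ rfl
      refine (replaceLabel_meets dec (L := labels a b j) ?_).mono (by simp [hun]) ?_
      · simpa [hun] using hl
      · rintro w ⟨hw, hw6⟩
        refine ⟨(((hu.setReg (by omega) _).setReg (by omega) _).setReg (by omega) _).trans hw, ?_⟩
        simpa [hun, labels] using hw6
    · simp [Expr.cost]; omega
  · simp [Expr.cost]; omega

theorem sumClass_meets {L : ℕ → ℕ} (hL : ∀ v < m.reg 0, m.arr 6 v = L v)
    (hR : ∀ v < m.reg 0, m.arr 4 v ≤ 1) :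
    sumClass.Meets dec m (4 + m.reg 0 * 21) fun u => Agree m u ∧ u.reg 8 ≤ 1 ∧
      (u.reg 8 : ZMod 2) = classSum (m.reg 0) L (fun v => (m.arr 4 v : ZMod 2)) (m.reg 6) := by
  refine (Program.Meets.seq (Program.Meets.set (Q := fun w => w = { m with
    reg := Function.update m.reg 8 0 }) rfl) (B' := 2 + m.reg 0 * 21) ?_).mono ?_ fun _ h => h
  · rintro _ rfl
    refine Program.Meets.mono (Program.Meets.loop (e := .reg 0)
      (B := (dist (.get 6 (.reg 5)) (.reg 6)).cost + 1 + 10)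
      (fun i u => Agree m u ∧ u.reg 6 = m.reg 6 ∧ u.arr 6 = m.arr 6 ∧ u.reg 8 ≤ 1 ∧
        (u.reg 8 : ZMod 2) = classSum i L (fun v => (m.arr 4 v : ZMod 2)) (m.reg 6))
      ⟨(Agree.refl m).setReg (by omega) _, by simp, rfl, by simp, by simp [classSum]⟩ ?_) ?_
      fun u hu => ?_
    · rintro i u hi ⟨hu, h6, ha6, hle, hsum⟩
      simp only [Expr.eval, Function.update_of_ne (show (0 : ℕ) ≠ 8 by omega)] at hi
      have hi' : u.arr 6 i = L i := by rw [ha6]; exact hL i hi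
      have h4 : u.arr 4 = m.arr 4 := hu.1 4 (by omega)
      have hcs : classSum (i + 1) L (fun v => (m.arr 4 v : ZMod 2)) (m.reg 6) =
          (u.reg 8 : ZMod 2) + if L i = m.reg 6 then (m.arr 4 i : ZMod 2) else 0 := by
        rw [hsum, classSum, Finset.sum_range_succ]; rfl
      rw [hcs]
      refine Program.Meets.ite (B := 10) (fun hd => ?_) fun hd => ?_
      · rw [Ne, eval_dist_eq_zero_iff] at hd
        simp only [Expr.eval, Function.update_self,
          Function.update_of_ne (show (6 : ℕ) ≠ 5 by omega), hi', h6] at hd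
        refine (Program.Meets.set ⟨(hu.setReg (by omega) i).setReg (by omega) _, ?_⟩).mono
          (by simp [Expr.cost]) fun _ h => h
        simp [h6, ha6, hle, hd]
      · rw [eval_dist_eq_zero_iff] at hd
        simp only [Expr.eval, Function.update_self,
          Function.update_of_ne (show (6 : ℕ) ≠ 5 by omega), hi', h6] at hd
        have hbits := eval_dist_bits (m := { u with reg := Function.update u.reg 5 i })
          (s := .reg 8) (t := .get 4 (.reg 5)) (by simpa [Expr.eval] using hle)
          (by simpa [Expr.eval, h4] using hR i hi)
        refine (Program.Meets.set ⟨(hu.setReg (by omega) i).setReg (by omega) _, ?_⟩).mono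
          (by simp [Expr.cost, dist]) fun _ h => h
        refine ⟨by simp [h6], ha6, by simpa using hbits.1, ?_⟩
        simp only [Function.update_self]
        rw [hbits.2, if_pos hd]
        simp [Expr.eval, h4]
    · simp [Expr.eval, Expr.cost, dist]
    · simpa [Expr.eval] using ⟨hu.1, hu.2.2.2⟩
  · simp [Expr.cost]; omega

theorem updateEdge_meets {n e : ℕ} {a b : ℕ → ℕ} (he : m.reg 3 = e)
    (h0 : m.arr 0 = a) (h1 : m.arr 1 = b) (ha : a e < n) (hb : b e < n)
    (hR : ∀ v < n, m.arr 4 v ≤ 1) (h8 : m.reg 8 ≤ 1) :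
    updateEdge.Meets dec m 40 fun u =>
      (∀ r, u.reg r = m.reg r) ∧ u.arr 0 = a ∧ u.arr 1 = b ∧
      u.arr 5 = Function.update (m.arr 5) e (m.reg 8) ∧
      ∀ v < n, u.arr 4 v ≤ 1 ∧
        (u.arr 4 v : ZMod 2) = (m.arr 4 v : ZMod 2) + incidence a b e v * (m.reg 8 : ZMod 2) := by
  set u₁ : Mem := { m with
    arr := Function.update m.arr 5 (Function.update (m.arr 5) (m.reg 3) (m.reg 8)) } with hu₁
  set x₁ : Expr := dist (.get 4 (.get 0 (.reg 3))) (.reg 8) with hx₁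
  set u₂ : Mem := { u₁ with
    arr := Function.update u₁.arr 4 (Function.update (u₁.arr 4) (u₁.arr 0 (u₁.reg 3)) (x₁.eval u₁)) } with hu₂
  set x₂ : Expr := dist (.get 4 (.get 1 (.reg 3))) (.reg 8) with hx₂
  set u₃ : Mem := { u₂ with
    arr := Function.update u₂.arr 4 (Function.update (u₂.arr 4) (u₂.arr 1 (u₂.reg 3)) (x₂.eval u₂)) } with hu₃
  have hrun : updateEdge.Meets dec m 40 fun u => u = u₃ := by
    refine ⟨rfl, ?_⟩
    simp [updateEdge, Program.run, Expr.cost, dist]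
  refine hrun.mono le_rfl ?_
  rintro _ rfl
  have e1 : u₁.arr 4 = m.arr 4 := by simp [hu₁]
  have e2 : u₂.arr 4 = Function.update (m.arr 4) (a e) (x₁.eval u₁) := by
    simp [hu₂, hu₁, h0, he]
  have e3 : u₃.arr 4 = Function.update (u₂.arr 4) (b e) (x₂.eval u₂) := by
    simp [hu₃, hu₂, hu₁, h1, he]
  have hx1 := eval_dist_bits (m := u₁) (s := .get 4 (.get 0 (.reg 3))) (t := .reg 8)
    (by simpa [Expr.eval, hu₁, h0, he] using hR _ ha) h8
  have hs1 : (Expr.get 4 (.get 0 (.reg 3))).eval u₁ = m.arr 4 (a e) := by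
    simp [Expr.eval, hu₁, h0, he]
  have ht1 : (Expr.reg 8).eval u₁ = m.reg 8 := rfl
  rw [hs1, ht1, ← hx₁] at hx1
  -- The state after the first end only. Writing the ends one after the other also treats a loop
  -- correctly: the second flip undoes the first.
  have h4 : ∀ v < n, u₂.arr 4 v ≤ 1 ∧ (u₂.arr 4 v : ZMod 2) =
      (m.arr 4 v : ZMod 2) + (if a e = v then 1 else 0) * (m.reg 8 : ZMod 2) := by
    intro v hv
    rw [e2]
    by_cases hv' : v = a e
    · subst hv'
      simpa using hx1
    · simpa [Function.update_of_ne hv', Ne.symm hv'] using hR v hv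
  have hs2 : (Expr.get 4 (.get 1 (.reg 3))).eval u₂ = u₂.arr 4 (b e) := by
    simp [Expr.eval, hu₂, hu₁, h1, he]
  have ht2 : (Expr.reg 8).eval u₂ = m.reg 8 := rfl
  have hx2 := eval_dist_bits (m := u₂) (s := .get 4 (.get 1 (.reg 3))) (t := .reg 8)
    (by rw [hs2]; exact (h4 _ hb).1) h8
  rw [hs2, ht2, ← hx₂] at hx2
  refine ⟨fun _ => rfl, by simp [hu₃, hu₂, hu₁, h0], by simp [hu₃, hu₂, hu₁, h1],
    by simp [hu₃, hu₂, hu₁, he], fun v hv => ?_⟩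
  rw [e3, incidence]
  by_cases hv' : v = b e
  · subst hv'
    rw [Function.update_self]
    refine ⟨hx2.1, ?_⟩
    rw [hx2.2, (h4 _ hb).2, if_pos rfl]
    ring
  · rw [Function.update_of_ne hv', if_neg (Ne.symm hv'), add_zero]
    exact h4 v hv

/-- The state of the decoder after `k` edges: array `4` holds the residual syndrome, array `5` the
estimate, and the residual syndrome is even on the classes that the remaining edges generate. -/
def Invariant (n l : ℕ) (a b : ℕ → ℕ) (s : ℕ → ZMod 2) (k : ℕ) (u : Mem) : Prop :=
  u.reg 0 = n ∧ u.reg 1 = l ∧ u.arr 0 = a ∧ u.arr 1 = b ∧ (∀ v < n, u.arr 4 v ≤ 1) ∧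
  (∀ j < l - k, u.arr 5 j = 0) ∧
  (∀ v < n, (u.arr 4 v : ZMod 2) =
    s v + ∑ j ∈ Finset.range l, incidence a b j v * (u.arr 5 j : ZMod 2)) ∧
  ∀ c, classSum n (labels a b (l - k)) (fun v => (u.arr 4 v : ZMod 2)) c = 0

theorem decodeEdge_meets {n l : ℕ} {a b : ℕ → ℕ} {s : ℕ → ZMod 2} (ha : ∀ j < l, a j < n)
    (hb : ∀ j < l, b j < n) {k : ℕ} (hk : k < l) (h : Invariant n l a b s k m) :
    decodeEdge.Meets dec { m with reg := Function.update m.reg 2 k }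
      (58 + n * 25 + l * (n * 15 + 11)) (Invariant n l a b s (k + 1)) := by
  obtain ⟨hn, hl, h0, h1, hR, hy, hsyn, hcls⟩ := h
  -- Round `k` treats this edge: before it the classes come from the edges up to and including `e`,
  -- after it from those below `e`.
  set e := l - 1 - k with he
  have hel : e < l := by omega
  have hek : l - k = e + 1 := by omega
  have hek' : l - (k + 1) = e := by omega
  refine Program.Meets.mono (Program.Meets.seq
    (Q := fun u => u.arr = m.arr ∧ u.reg 0 = n ∧ u.reg 1 = l ∧ u.reg 3 = e)
    (B' := 52 + n * 25 + e * (n * 15 + 11)) (Program.Meets.set ?_) ?_) ?_ fun _ h => h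
  · simp [Expr.eval, hn, hl, he]
  · rintro u₀ ⟨harr, hn₀, hl₀, he₀⟩
    refine (Program.Meets.seq (initLabels_meets dec) (B' := 50 + n * 21 + e * (n * 15 + 11))
      ?_).mono (by rw [hn₀]; omega) fun _ h => h
    rintro u₁ ⟨hu₁, hlab₁⟩
    rw [hn₀] at hlab₁
    refine (Program.Meets.seq (mergeEdges_meets dec ((hu₁.2 0 (by omega)).trans hn₀)
      ((hu₁.2 3 (by omega)).trans he₀) ((hu₁.1 0 (by omega)).trans (by rw [harr, h0]))
      ((hu₁.1 1 (by omega)).trans (by rw [harr, h1])) (fun j hj => ha j (by omega))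
      (fun j hj => hb j (by omega)) hlab₁) (B' := 48 + n * 21) ?_).mono (by omega) fun _ h => h
    rintro u₂ ⟨hu₂, hlab₂⟩
    have hA := hu₁.trans hu₂
    have e₂ : u₂.reg 3 = e := (hA.2 3 (by omega)).trans he₀
    have a₂ : u₂.arr 0 = a := (hA.1 0 (by omega)).trans (by rw [harr, h0])
    have n₂ : u₂.reg 0 = n := (hA.2 0 (by omega)).trans hn₀
    have r₂ : u₂.arr 4 = m.arr 4 := (hA.1 4 (by omega)).trans (by rw [harr])
    refine (Program.Meets.seq (Program.Meets.set
      (Q := fun w => w = { u₂ with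
        reg := Function.update u₂.reg 6 (labels a b e (a e)) }) ?_) (B' := 44 + n * 21)
      ?_).mono (by simp [Expr.cost]; omega) fun _ h => h
    · simp [Expr.eval, e₂, a₂, hlab₂ _ (ha e hel)]
    · rintro _ rfl
      refine (Program.Meets.seq (sumClass_meets dec (L := labels a b e) ?_ ?_) (B' := 40)
        ?_).mono (by simp [n₂]; omega) fun _ h => h
      · simpa [n₂] using hlab₂
      · simpa [n₂, r₂] using hR
      · rintro u₃ ⟨hu₃, hle, hacc⟩
        have hA₃ := (hA.setReg (r := 6) (by omega) (labels a b e (a e))).trans hu₃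
        have r₃ : u₃.arr 4 = m.arr 4 := (hA₃.1 4 (by omega)).trans (by rw [harr])
        have y₃ : u₃.arr 5 = m.arr 5 := (hA₃.1 5 (by omega)).trans (by rw [harr])
        simp only [Function.update_of_ne (show (0 : ℕ) ≠ 6 by omega), n₂, r₂,
          Function.update_self] at hacc
        refine (updateEdge_meets dec ((hA₃.2 3 (by omega)).trans he₀)
          ((hA₃.1 0 (by omega)).trans (by rw [harr, h0]))
          ((hA₃.1 1 (by omega)).trans (by rw [harr, h1])) (ha e hel) (hb e hel)
          (by rw [r₃]; exact hR) hle).mono le_rfl ?_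
        rintro w ⟨hreg, hw0, hw1, hw5, hw4⟩
        rw [y₃] at hw5
        rw [r₃] at hw4
        refine ⟨(hreg 0).trans ((hA₃.2 0 (by omega)).trans hn₀),
          (hreg 1).trans ((hA₃.2 1 (by omega)).trans hl₀), hw0, hw1, fun v hv => (hw4 v hv).1,
          fun j hj => ?_, fun v hv => ?_, ?_⟩
        · rw [hw5, Function.update_of_ne (by omega)]
          exact hy j (by omega)
        -- The estimate at `e` was still zero, so writing it adds exactly one term to the sum over
        -- edges.
        · rw [(hw4 v hv).2, hsyn v hv, add_assoc, hw5,
            ← Finset.add_sum_erase _ _ (Finset.mem_range.2 hel),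
            ← Finset.add_sum_erase (Finset.range l) _ (Finset.mem_range.2 hel), hy e (by omega),
            Function.update_self, Nat.cast_zero, mul_zero, zero_add, add_comm (∑ _ ∈ _, _)]
          congr 2
          refine Finset.sum_congr rfl fun j hj => ?_
          rw [Function.update_of_ne (Finset.ne_of_mem_erase hj)]
        · rw [hek']
          rw [hek] at hcls
          refine classSum_update (ha e hel) (hb e hel) hcls fun v hv => ?_
          rw [(hw4 v hv).2, hacc]
  · have := Nat.mul_le_mul_right (n * 15 + 11) hel.le
    simp [Expr.cost]
    omega

/-- There are `l` rounds, each relabelling `n` vertices for at most `l` edges. -/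
theorem program_meets {n l : ℕ} {a b : ℕ → ℕ} {x : ℕ → ZMod 2} (ha : ∀ j < l, a j < n)
    (hb : ∀ j < l, b j < n) (hn : m.reg 0 = n) (hl : m.reg 1 = l) (h0 : m.arr 0 = a)
    (h1 : m.arr 1 = b) (hR : ∀ v < n, m.arr 4 v ≤ 1) (hy : ∀ j, m.arr 5 j = 0)
    (hx : ∀ v < n, (m.arr 4 v : ZMod 2) = ∑ j ∈ Finset.range l, incidence a b j v * x j) :
    program.Meets dec m (100 * (n + 1) * (l + 1) ^ 2) fun u => ∀ v < n,
      ∑ j ∈ Finset.range l, incidence a b j v * (u.arr 5 j : ZMod 2) =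
        ∑ j ∈ Finset.range l, incidence a b j v * x j := by
  refine (Program.Meets.loop (e := .reg 1) (B := 58 + n * 25 + l * (n * 15 + 11))
    (Invariant n l a b fun v => ∑ j ∈ Finset.range l, incidence a b j v * x j) ?_ ?_).mono ?_ ?_
  · refine ⟨hn, hl, h0, h1, hR, fun j _ => hy j, fun v hv => ?_, fun c => ?_⟩
    · simp [hx v hv, hy]
    · rw [← classSum_boundary ha hb x c]
      exact classSum_congr (fun _ _ => rfl) hx
  · intro k u hk hu
    exact decodeEdge_meets dec ha hb (by rwa [← hl]) hu
  · simp only [Expr.eval, Expr.cost, hl]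
    nlinarith [Nat.zero_le (n * l), Nat.zero_le (n * l ^ 2), Nat.zero_le (l ^ 2)]
  · rintro u ⟨-, -, -, -, -, -, hsyn, hcls⟩ v hv
    have hneg : ∀ s t : ZMod 2, 0 = s + t → t = s := by decide
    refine hneg _ _ ?_
    -- With no edges left each class is a single vertex, so its class sum is the residual bit there.
    rw [← hsyn v hv, ← hcls v]
    simp only [Expr.eval, hl, Nat.sub_self, classSum, labels]
    rw [Finset.sum_ite_eq' , if_pos (Finset.mem_range.2 hv)]

end program

/-! ### From numbered arrays back to embedded graphs -/

section correctness

theorem _root_.IsNumbering.sum_range {A B : Type} [Fintype A] [AddCommMonoid B] {f : A → ℕ} {n : ℕ}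
    (h : IsNumbering f n) (g : ℕ → B) : ∑ j ∈ Finset.range n, g j = ∑ a, g (f a) := by
  symm
  refine Finset.sum_nbij f (fun a _ => Finset.mem_range.2 (h.lt a)) (h.1.injOn) ?_ fun _ _ => rfl
  intro j hj
  obtain ⟨a, rfl⟩ := h.exists_eq (Finset.mem_range.1 (Finset.mem_coe.1 hj))
  exact ⟨a, by simp, rfl⟩

variable {D V E F : Type} [Fintype D] [Fintype E] {M : EmbeddedGraph D V E F}
  {I : SurfaceInstance} {s : V → ZMod 2} {numV : V → ℕ} {numE : E → ℕ} {numF : F → ℕ}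

theorem boundary_eq_sum_incidence (h : I.Describes M s numV numE numF) (y : ℕ → ZMod 2) (v : V) :
    M.boundary (fun e => y (numE e)) v = ∑ j ∈ Finset.range I.ends.length,
      incidence (I.load.arr 0) (I.load.arr 1) j (numV v) * y j := by
  classical
  rw [h.edges.sum_range, EmbeddedGraph.boundary, Finset.sum_filter,
    ← Finset.sum_fiberwise Finset.univ M.edge]
  refine Finset.sum_congr rfl fun e _ => ?_
  obtain ⟨d, rfl, hd, -⟩ := h.incidence e
  have h0 : I.load.arr 0 (numE (M.edge d)) = numV (M.vert d) := congrArg Prod.fst hd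
  have h1 : I.load.arr 1 (numE (M.edge d)) = numV (M.vert (M.α d)) := congrArg Prod.snd hd
  rw [M.sum_edge_eq, incidence, h0, h1, M.edge_α]
  simp only [h.vertices.1.eq_iff, add_mul, ite_mul, one_mul, zero_mul]

theorem toDecoder_spec {x : E → ZMod 2} (h : I.Describes M (M.boundary x) numV numE numF) :
    M.boundary (readOff numE fun i => (program.toDecoder I).1.getD i 0) = M.boundary x ∧
      (program.toDecoder I).2 ≤ 100 * (I.syn.length + 1) * (I.ends.length + 1) ^ 2 := by
  have hends : ∀ j < I.ends.length, I.load.arr 0 j < I.syn.length ∧ I.load.arr 1 j < I.syn.length := by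
    intro j hj
    obtain ⟨e, rfl⟩ := h.edges.exists_eq hj
    obtain ⟨d, -, hd, -⟩ := h.incidence e
    have h0 : I.load.arr 0 (numE e) = numV (M.vert d) := congrArg Prod.fst hd
    have h1 : I.load.arr 1 (numE e) = numV (M.vert (M.α d)) := congrArg Prod.snd hd
    exact ⟨h0 ▸ h.vertices.lt _, h1 ▸ h.vertices.lt _⟩
  -- The error is moved to edge numbers; the default 0 is never seen, because only numbers of edges
  -- occur.
  have hx : (fun e => Function.extend numE x 0 (numE e)) = x :=
    funext fun e => h.edges.1.extend_apply x 0 e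
  have hsyn : ∀ v, I.load.arr 4 (numV v) = (M.boundary x v).val := h.syndrome
  obtain ⟨hrun, hcost⟩ := program_meets (fun _ => ([], 0)) (m := I.load)
    (x := Function.extend numE x 0) (fun j hj => (hends j hj).1) (fun j hj => (hends j hj).2) rfl rfl
    rfl rfl (by
      intro i hi
      obtain ⟨v, rfl⟩ := h.vertices.exists_eq hi
      rw [hsyn]
      exact Nat.le_of_lt_succ (ZMod.val_lt _)) (fun _ => rfl) (by
      intro i hi
      obtain ⟨v, rfl⟩ := h.vertices.exists_eq hi
      rw [hsyn, ← boundary_eq_sum_incidence h, hx, ZMod.natCast_zmod_val])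
  refine ⟨?_, hcost⟩
  funext v
  have hv := hrun (numV v) (h.vertices.lt v)
  rw [← boundary_eq_sum_incidence h, ← boundary_eq_sum_incidence h, hx] at hv
  rw [← hv]
  congr 1
  funext e
  rw [readOff, Program.toDecoder, List.getD_map_range _ _ (h.edges.lt e)]

theorem isSurfaceDecoder : IsSurfaceDecoder program.toDecoder :=
  fun _ _ _ _ _ _ _ _ _ _ _ _ _ h => (toDecoder_spec h).1

end correctness

end SurfaceDecoder

/-! ## The decoding program is correct -/

namespace Decoding

variable {D V E F : Type} [Fintype D] [Fintype V] [Fintype E] {C : SubsystemSurfaceCode D V E F}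
  {numD : D → ℕ} {numV : V → ℕ} {numE : E → ℕ} {numF : F → ℕ}

/-- The decoding program presents an instance for each type of error to the decoder, leaves the
two answers in the output arrays, and takes linearly many further steps. -/
theorem program_meets (dec : Decoder) {s : Kind → F → ZMod 2} {m : Mem}
    (h : m.Holds C s numD numV numE numF) :
    ∃ I : Kind → SurfaceInstance, (∀ κ, (I κ).Describes (C.decodingGraph κ) (s κ.swap) numF
        (qubitNumber numV numE) (triangleNumber C numD κ)) ∧
      program.Meets dec m
        (10 + m.reg 0 * 202 + 2 * m.reg 3 + 2 * (m.reg 2 + m.reg 1) + (dec (I .X)).2 + (dec (I .Z)).2)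
        fun u => ∀ κ i, u.arr (outArray κ) i = (dec (I κ)).1.getD i 0 := by
  set m₀ : Mem := { m with reg := Function.update m.reg 10 (m.reg 2 + m.reg 1) } with hm₀
  have h₀ : m₀.Holds C s numD numV numE numF :=
    holds_of_agree (m := m) (fun _ _ => rfl) (fun r hr => Function.update_of_ne (by omega) _ _) h
  obtain ⟨I, hI, hrun⟩ := decodePart_meets dec h₀ (by simp [hm₀]) .X
  set u := ((decodePart .X).run dec m₀).1 with hu
  obtain ⟨⟨harr, hreg, hout⟩, hcost⟩ := hrun
  have h₁ : u.Holds C s numD numV numE numF :=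
    holds_of_agree (fun a ha => harr a (by omega) (by simp only [outArray]; omega))
      (fun r hr => hreg r (by omega)) h₀
  obtain ⟨I', hI', ⟨harr', hreg', hout'⟩, hcost'⟩ := decodePart_meets dec h₁
    (by rw [hreg 10 (by omega), hreg 1 (by omega), hreg 2 (by omega)]; simp [hm₀]) .Z
  refine ⟨fun | .X => I | .Z => I', fun | .X => hI | .Z => hI', ?_, ?_⟩
  · rintro (_ | _) i
    · exact (congrFun (harr' 8 (by omega) (by simp [outArray])) i).trans (hout i)
    · exact hout' i
  · rw [hreg 0 (by omega), hreg 3 (by omega), hreg 10 (by omega)] at hcost'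
    have hm : m₀.reg 0 = m.reg 0 ∧ m₀.reg 3 = m.reg 3 ∧ m₀.reg 10 = m.reg 2 + m.reg 1 := by
      simp [hm₀]
    rw [hm.1, hm.2.1, hm.2.2] at hcost hcost'
    -- The initial assignment costs 4, and each of the two parts brings a constant 3, which makes
    -- 10.
    have hsplit : (program.run dec m).2 = 4 + (((decodePart .X).run dec m₀).2 +
        ((decodePart .Z).run dec u).2) := rfl
    show _ ≤ _ + (dec I).2 + (dec I').2
    rw [hsplit]
    omega

theorem card_face_le [Fintype F] (C : SubsystemSurfaceCode D V E F) :
    Fintype.card F ≤ 2 * Fintype.card (E ⊕ V) := by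
  have h1 := Fintype.card_le_of_surjective _ C.face_surj
  have h2 := C.card_dart_eq_two_mul_card_edge
  rw [Fintype.card_sum]
  omega

/-- From $|D|=2|E|=4|V|$ follows $n=3|V|$. Connectedness includes a dart, so $n>0$ and the additive
constant is absorbed. -/
theorem program_cost_le [Fintype F] {s : Kind → F → ZMod 2} {m : Mem} (hC : C.Connected)
    (h : m.Holds C s numD numV numE numF) :
    10 + m.reg 0 * 202 + 2 * m.reg 3 + 2 * (m.reg 2 + m.reg 1) ≤
      500 * Fintype.card (E ⊕ V) := by
  have h0 := h.darts.card_eq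
  have h1 := h.vertices.card_eq
  have h2 := h.edges.card_eq
  have h3 := h.faces.card_eq
  have h4 := card_face_le C
  have h5 := C.card_dart_eq_two_mul_card_edge
  have h6 := C.card_dart_eq_four_mul_card_vert
  have h7 : 0 < Fintype.card D := Fintype.card_pos_iff.2 hC.1
  rw [Fintype.card_sum] at *
  omega

end Decoding

/-! ### The main theorem -/

theorem mainTheorem10 :
    (∀ (D V E F : Type) [Fintype D] [Fintype V] [Fintype E] [Fintype F]
        (C : SubsystemSurfaceCode D V E F) (g : ℕ), C.HasGenus g →
      -- the checks are gauge operators that commute with all gauge operators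
      (∀ τ f, C.stabilizer τ f ∈ C.gaugeGroup ∧
        ∀ h ∈ C.gaugeGroup, Commute h (C.stabilizer τ f)) ∧
      -- the two decoding graphs lie on the same surface, the checks of one type are the vertex
      -- operators and the gauge operators of the other type the face operators
      (∀ κ, (C.decodingGraph κ).HasGenus g ∧
        (∀ f, C.stabilizer κ.swap f = Pauli.op κ.swap ((C.decodingGraph κ).star f)) ∧
        (∀ d, C.gaugeOp d.1 = Pauli.op κ ((C.decodingGraph κ).plaquette d))) ∧
      -- bit flips and phase flips decouple, and each syndrome is the surface-code syndrome
      (∀ (err : Pauli (E ⊕ V)) (κ : Kind),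
        C.projectedSyndrome err κ = (C.decodingGraph κ).boundary (err.part κ) ∧
        ∀ f, Pauli.syndrome (Pauli.op κ.swap ((C.decodingGraph κ).star f))
          (Pauli.op κ (err.part κ)) = (C.decodingGraph κ).boundary (err.part κ) f) ∧
      -- lifting is one-to-one, and onto all errors up to scalars
      (∀ err : Pauli (E ⊕ V), ∃! y : Kind → E ⊕ V → ZMod 2,
        ∃ k : ℕ, err = Pauli.imag ^ k * liftError y) ∧
      -- lifted estimates with the right syndromes have the right syndrome, and they correct
      -- the error if and only if both surface-code estimates correct the projected errors
      (∀ (err : Pauli (E ⊕ V)) (y : Kind → E ⊕ V → ZMod 2),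
        (∀ κ, (C.decodingGraph κ).boundary (y κ) = C.projectedSyndrome err κ) →
          (∀ τ f, Pauli.syndrome (C.stabilizer τ f) (liftError y) =
            Pauli.syndrome (C.stabilizer τ f) err) ∧
          (err * liftError y ∈ C.harmless ↔
            ∀ κ, Pauli.op κ (err.part κ + y κ) ∈
              (C.decodingGraph κ).surfaceStabilizer κ.swap))) ∧
    -- one program carries this out with any surface-code decoder, with linear overhead
    (∃ (P : Program) (c : ℕ),
      (∀ (dec : Decoder), IsSurfaceDecoder dec →
        ∀ (D V E F : Type) [Fintype D] [Fintype V] [Fintype E] [Fintype F]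
          (C : SubsystemSurfaceCode D V E F) (err : Pauli (E ⊕ V))
          (numD : D → ℕ) (numV : V → ℕ) (numE : E → ℕ) (numF : F → ℕ) (m : Mem), C.Connected →
          m.Holds C (fun τ f => Pauli.syndrome (C.stabilizer τ f) err) numD numV numE numF →
          ∃ (I : Kind → SurfaceInstance) (numT : ∀ κ, {d : D // C.col d = κ} → ℕ)
            (y : Kind → E ⊕ V → ZMod 2),
            (∀ κ, (I κ).Describes (C.decodingGraph κ) (C.projectedSyndrome err κ)
              numF (qubitNumber numV numE) (numT κ)) ∧
            (∀ κ i, (P.run dec m).1.arr (outArray κ) i = (dec (I κ)).1.getD i 0) ∧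
            (∀ κ, y κ = readOff (qubitNumber numV numE) ((P.run dec m).1.arr (outArray κ))) ∧
            (∀ τ f, Pauli.syndrome (C.stabilizer τ f) (liftError y) =
              Pauli.syndrome (C.stabilizer τ f) err) ∧
            (err * liftError y ∈ C.harmless ↔
              ∀ κ, Pauli.op κ (err.part κ + y κ) ∈
                (C.decodingGraph κ).surfaceStabilizer κ.swap) ∧
            (P.run dec m).2 ≤
              c * Fintype.card (E ⊕ V) + (dec (I .X)).2 + (dec (I .Z)).2) ∧
      -- and with a suitable surface-code decoder it runs in polynomial time
      (∃ (S : Program) (q : Polynomial ℕ), IsSurfaceDecoder S.toDecoder ∧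
        ∀ (D V E F : Type) [Fintype D] [Fintype V] [Fintype E] [Fintype F]
          (C : SubsystemSurfaceCode D V E F) (err : Pauli (E ⊕ V))
          (numD : D → ℕ) (numV : V → ℕ) (numE : E → ℕ) (numF : F → ℕ) (m : Mem), C.Connected →
          m.Holds C (fun τ f => Pauli.syndrome (C.stabilizer τ f) err) numD numV numE numF →
          (P.run S.toDecoder m).2 ≤ q.eval (Fintype.card (E ⊕ V)))) := by
  refine ⟨fun D V E F _ _ _ _ C g hg => ⟨fun τ f => ⟨C.stabilizer_mem_gaugeGroup τ f,
    fun h hh => C.commute_stabilizer τ f hh⟩, fun κ => ⟨C.decodingGraph_hasGenus hg κ,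
    C.stabilizer_eq κ, C.gaugeOp_eq κ⟩, fun err κ => ⟨C.projectedSyndrome_eq err κ, fun f => ?_⟩,
    existsUnique_lift, fun err y hy => ⟨C.syndrome_liftError err y hy,
    C.mul_liftError_mem_harmless_iff err y⟩⟩, Decoding.program, 500, ?_,
    -- Linear overhead plus two calls on instances with $n$ edges and at most $2n$ vertices, the
    -- faces of the original graph.
    SurfaceDecoder.program, .C 500 * .X + .C 200 * (.C 2 * .X + 1) * (.X + 1) ^ 2,
    SurfaceDecoder.isSurfaceDecoder, ?_⟩
  · rw [C.syndrome_op_star, Pauli.part_op_self]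
  · intro dec hdec D V E F _ _ _ _ C err numD numV numE numF m hC hm
    obtain ⟨I, hI, hout, hcost⟩ := Decoding.program_meets dec hm
    have hy : ∀ κ, (C.decodingGraph κ).boundary (readOff (qubitNumber numV numE)
        (((Decoding.program.run dec m).1).arr (outArray κ))) = C.projectedSyndrome err κ := by
      intro κ
      have hD : (I κ).Describes (C.decodingGraph κ) (C.projectedSyndrome err κ) numF
        (qubitNumber numV numE) (Decoding.triangleNumber C numD κ) := hI κ
      -- The decoder is only specified on syndromes that some error causes; here the part of `err`
      -- is such an error.
      rw [C.projectedSyndrome_eq] at hD ⊢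
      rw [funext (hout κ)]
      exact hdec _ _ _ _ _ (SubsystemSurfaceCode.decodingGraph_connected hC κ) _ _ _ _ _ hD
    exact ⟨I, Decoding.triangleNumber C numD, _, hI, hout, fun _ => rfl,
      C.syndrome_liftError err _ hy, C.mul_liftError_mem_harmless_iff err _,
      hcost.trans (by have := Decoding.program_cost_le hC hm; omega)⟩
  · intro D V E F _ _ _ _ C err numD numV numE numF m hC hm
    obtain ⟨I, hI, -, hcost⟩ := Decoding.program_meets SurfaceDecoder.program.toDecoder hm
    have hle := Decoding.program_cost_le hC hm
    have hdec : ∀ κ, (SurfaceDecoder.program.toDecoder (I κ)).2 ≤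
        100 * (2 * Fintype.card (E ⊕ V) + 1) * (Fintype.card (E ⊕ V) + 1) ^ 2 := by
      intro κ
      have hD : (I κ).Describes (C.decodingGraph κ) (C.projectedSyndrome err κ) numF
        (qubitNumber numV numE) (Decoding.triangleNumber C numD κ) := hI κ
      rw [C.projectedSyndrome_eq] at hD
      refine (SurfaceDecoder.toDecoder_spec hD).2.trans ?_
      rw [← hD.vertices.card_eq, ← hD.edges.card_eq]
      have := Decoding.card_face_le C
      gcongr
    have hX := hdec .X
    have hZ := hdec .Z
    simp only [Polynomial.eval_add, Polynomial.eval_mul, Polynomial.eval_pow, Polynomial.eval_C,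
      Polynomial.eval_X, Polynomial.eval_one]
    nlinarith
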